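/- **Protocol.** Let $N,s\ge 1$, $\varepsilon>0$, $\delta\in(0,1)$, $\sigma\in(0,1)$, and let $D$ be a distribution on $[N]$. Put $p_{\max}=\frac{\log(1/\delta)}{\varepsilon s}$, $p_{\min}=\frac{\sigma}{N}$, $\tau=\sigma^3$, $B=\frac{\log(p_{\max}/p_{\min})}{\tau}$, $b_{\min}=\frac{\sigma}{2B}s$, $\Delta=3\log s+\frac{5\log(1/\delta)}{\varepsilon}$. All logarithms are natural, and $\mathrm{Lap}(c,b)$ denotes $c$ plus fresh independent Laplace noise of scale $b$. 1. The verifier draws $S_1,\dots,S_s$ i.i.d. uniform on $[N]$, rejects if some element of $[N]$ appears more than $3$ times, and otherwise sends $S$ to the prover. 2. The prover returns real tags $\pi_1,\dots,\pi_s$. The honest prover sends $\pi_i=D(S_i)$ if $D(S_i)\ge p_{\min}$ and $\pi_i=0$ otherwise. The verifier rejects unless every $\pi_i$ lies in $\{0\}\cup[p_{\min},p_{\max}]$. 3. The verifier draws fresh independent samples $T,T'\sim D^s$, computes $m(T)=\max_k|\{r:S_k=T_r\}|$ and $m(T')$ likewise, and rejects if $\mathrm{Lap}(\max\{m(T),m(T')\},1/\varepsilon)>\Delta-\log(1/\delta)/\varepsilon$.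 4. For every integer $j$ with $e^{j\tau}/N\le p_{\max}$ and $p_{\min}<e^{(j+1)\tau}/N$, let $S^j=\{i:\pi_i\in[e^{j\tau}/N,e^{(j+1)\tau}/N)\}$, let $C^{\mathrm{pair}}_j$ be the number of $(k,r)$ with $k\in S^j$, $S_k=T_r$, and let $C^{\mathrm{triple}}_j$ be the number of $(k,r,r')$ with $k\in S^j$, $S_k=T_r=T'_{r'}$. The verifier rejects if some such $j$ with $|S^j|\ge b_{\min}$ violates $$\mathrm{Lap}\bigl(C^{\mathrm{pair}}_j,\tfrac3\varepsilon\bigr)\in(1\pm8\tau)\,s|S^j|\tfrac{e^{j\tau}}{N}\quad\text{or}\quad \mathrm{Lap}\bigl(C^{\mathrm{triple}}_j,\tfrac{3\Delta}\varepsilon\bigr)\in(1\pm8\tau)\,s^2|S^j|\bigl(\tfrac{e^{j\tau}}{N}\bigr)^2 .$$ 5. Let $C^{\mathrm{pair}}_{-\infty}$ be the number of $(k,r)$ with $\pi_k=0$, $S_k=T_r$. The verifier rejects if $\mathrm{Lap}(C^{\mathrm{pair}}_{-\infty},3/\varepsilon)>2p_{\min}s^2$. 6. Otherwise the verifier accepts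 and outputs $(S_1,\pi_1),\dots,(S_s,\pi_s)$. Write $$\mathrm{err}(S,\pi)=\frac1s\sum_{i:\pi_i\ge\sigma/N}\Bigl(1-\min\Bigl\{\frac{\pi_i}{D(S_i)},\frac{D(S_i)}{\pi_i}\Bigr\}\Bigr),\qquad \mathrm{light}(S,\pi)=\frac1s\sum_{i:\pi_i<\sigma/N}D(S_i),$$ where a summand of $\mathrm{err}$ with $D(S_i)=0$ equals $1$. For $a,k\in\mathbb N$ put $\Lambda_{a,k}=(N/\varepsilon)^{2/3}(\log N)^a(\log(1/\delta)/\sigma)^k$. **Theorem.** There are absolute constants $C>0$ and $a_0,k_0\in\mathbb N$ such that for all constants $\varepsilon_0,K\in\mathbb R$, $a,k\in\mathbb N$ and every function $\varphi:\mathbb N\to\mathbb R$ with $\varphi(N)\to0$ there is an $N_0$ with the following property. Let $N\ge N_0$, $0<\varepsilon\le\varepsilon_0$, $0<\delta\le\frac12$, $0<\sigma<1$ satisfy $\frac{\log(1/\delta)}{\varepsilon\sigma}\le N^{\varphi(N)}$, let $s$ be an integer with $\Lambda_{a_0,k_0}\le s\le K\Lambda_{a,k}$ (so $s=\tilde O(N^{2/3}/\varepsilon^{2/3})\cdot\mathrm{poly}(\log(1/\delta)/\sigma)$),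 and let $D$ be a distribution on $[N]$ with $\max_xD(x)\le p_{\max}$. Then: * **Completeness.** With the honest prover, with probability at least $3/4$ the verifier accepts and outputs tagged samples with $\mathrm{err}(S,\pi)\le C\sigma^3$ and $\mathrm{light}(S,\pi)\le C\sigma/N$. * **Soundness.** With any prover (computationally unbounded, possibly randomized, and knowing $D$), with probability at least $3/4$ the verifier rejects or outputs tagged samples with $\mathrm{err}(S,\pi)\le C\sigma$ and $\mathrm{light}(S,\pi)\le C\sigma/N$. -/

import Mathlib

open MeasureTheory ProbabilityTheory Filter Topology

noncomputable section

/-- The centred Laplace distribution `Lap(0, b)` on `ℝ`, with density `e^{-|x|/b} / (2b)`. -/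
def laplaceMeasure (b : ℝ) : Measure ℝ :=
  volume.withDensity fun x => ENNReal.ofReal (Real.exp (-|x| / b) / (2 * b))

namespace TaggedSample

/-- The parameters of the protocol: domain size `N`, sample size `s`, privacy parameters
`ε, δ` and proximity parameter `σ`. -/
structure Params where
  N : ℕ
  s : ℕ
  ε : ℝ
  δ : ℝ
  σ : ℝ

namespace Params

variable (p : Params)

/-- `p_max = log(1/δ) / (ε s)`. -/
def pMax : ℝ := Real.log (1 / p.δ) / (p.ε * p.s)

/-- `p_min = σ / N`. -/
def pMin : ℝ := p.σ / p.N

/-- `τ = σ³`. -/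
def tau : ℝ := p.σ ^ 3

/-- `B = log(p_max / p_min) / τ`. -/
def B : ℝ := Real.log (p.pMax / p.pMin) / p.tau

/-- `b_min = (σ / 2B) s`. -/
def bMin : ℝ := p.σ / (2 * p.B) * p.s

/-- `Δ = 3 log s + 5 log(1/δ) / ε`. -/
def Delta : ℝ := 3 * Real.log p.s + 5 * Real.log (1 / p.δ) / p.ε

/-- The left end point `e^{jτ} / N` of the `j`-th bin. -/
def binLeft (j : ℤ) : ℝ := Real.exp (j * p.tau) / p.N

/-- The indices `j` of the bins `[e^{jτ}/N, e^{(j+1)τ}/N)` that are needed to cover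
`[p_min, p_max]`; see `mem_bins`. -/
def bins : Finset ℤ :=
  Finset.Icc ⌊Real.log (p.N * p.pMin) / p.tau⌋ ⌊Real.log (p.N * p.pMax) / p.tau⌋

/-- A bin index is used iff `e^{jτ}/N ≤ p_max` and `p_min < e^{(j+1)τ}/N`. -/
theorem mem_bins (hN : 0 < p.N) (hσ : 0 < p.σ) (hmax : 0 < p.pMax) (j : ℤ) :
    j ∈ p.bins ↔ p.binLeft j ≤ p.pMax ∧ p.pMin < p.binLeft (j + 1) := by
  have hN' : (0 : ℝ) < p.N := by exact_mod_cast hN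
  have hτ : 0 < p.tau := pow_pos hσ 3
  have hmin : 0 < p.pMin := div_pos hσ hN'
  have h1 : ⌊Real.log (p.N * p.pMin) / p.tau⌋ ≤ j ↔ p.pMin < p.binLeft (j + 1) := by
    rw [← Int.lt_add_one_iff, Int.floor_lt, div_lt_iff₀ hτ,
      Real.log_lt_iff_lt_exp (by positivity), binLeft, lt_div_iff₀ hN', mul_comm]
  have h2 : j ≤ ⌊Real.log (p.N * p.pMax) / p.tau⌋ ↔ p.binLeft j ≤ p.pMax := by
    rw [Int.le_floor, le_div_iff₀ hτ, Real.le_log_iff_exp_le (by positivity), binLeft,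
      div_le_iff₀ hN', mul_comm p.pMax]
  rw [bins, Finset.mem_Icc, h1, h2, and_comm]

/-- A sequence of `s` elements of the domain. -/
abbrev Sample : Type := Fin p.s → Fin p.N

/-- The prover's message: one real tag for each of the `s` elements sent by the verifier. -/
abbrev Tags : Type := Fin p.s → ℝ

/-- The verifier's private noise: for the propose-test-release test, for the pair count and
the triple count of every bin, and for the light pair count. -/
abbrev Noise : Type := ℝ × (p.bins → ℝ) × (p.bins → ℝ) × ℝ

end Params

variable (p : Params)

/-- Step 1 passes: no domain element occurs more than `3` times in `S`. -/
def SeedCheck (S : p.Sample) : Prop :=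
  ∀ x : Fin p.N, (Finset.univ.filter fun i => S i = x).card ≤ 3

/-- The prover's message is well formed: each tag is `0` or lies in `[p_min, p_max]`. -/
def FormatCheck (π : p.Tags) : Prop :=
  ∀ i, π i = 0 ∨ (p.pMin ≤ π i ∧ π i ≤ p.pMax)

/-- `m(T) = max_k |{r : S_k = T_r}|`. -/
def maxCollision (S T : p.Sample) : ℕ :=
  Finset.univ.sup fun k => (Finset.univ.filter fun r => S k = T r).card

/-- The propose-test-release test passes: the verifier rejects if
`Lap(max{m(T), m(T')}, 1/ε) > Δ - log(1/δ)/ε`. The noise `ν` is drawn from `Lap(0, 1/ε)`. -/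
def PTRCheck (S T T' : p.Sample) (ν : ℝ) : Prop :=
  ((max (maxCollision p S T) (maxCollision p S T') : ℕ) : ℝ) + ν
    ≤ p.Delta - Real.log (1 / p.δ) / p.ε

/-- The bin `S^j` of indices whose tag lies in `[e^{jτ}/N, e^{(j+1)τ}/N)`. -/
def bin (π : p.Tags) (j : ℤ) : Finset (Fin p.s) :=
  Finset.univ.filter fun i => p.binLeft j ≤ π i ∧ π i < p.binLeft (j + 1)

/-- The light bin `S^{-∞}` of indices tagged `0`. -/
def lightBin (π : p.Tags) : Finset (Fin p.s) :=
  Finset.univ.filter fun i => π i = 0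

/-- Number of `(k, r)` with `k ∈ I` and `S_k = T_r`. -/
def pairCount (S T : p.Sample) (I : Finset (Fin p.s)) : ℕ :=
  (Finset.univ.filter fun q : Fin p.s × Fin p.s => q.1 ∈ I ∧ S q.1 = T q.2).card

/-- Number of `(k, r, r')` with `k ∈ I` and `S_k = T_r = T'_{r'}`. -/
def tripleCount (S T T' : p.Sample) (I : Finset (Fin p.s)) : ℕ :=
  (Finset.univ.filter fun q : Fin p.s × Fin p.s × Fin p.s =>
    q.1 ∈ I ∧ S q.1 = T q.2.1 ∧ T q.2.1 = T' q.2.2).card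

/-- `c ∈ (1 ± 8τ) · x`. -/
def Close (c x : ℝ) : Prop :=
  (1 - 8 * p.tau) * x ≤ c ∧ c ≤ (1 + 8 * p.tau) * x

/-- Every bin with at least `b_min` elements passes the noisy pair and triple tests. -/
def BinCheck (S : p.Sample) (π : p.Tags) (T T' : p.Sample) (ν₂ ν₃ : p.bins → ℝ) : Prop :=
  ∀ j : p.bins, p.bMin ≤ ((bin p π j).card : ℝ) →
    Close p (pairCount p S T (bin p π j) + ν₂ j)
        (p.s * (bin p π j).card * p.binLeft j) ∧
    Close p (tripleCount p S T T' (bin p π j) + ν₃ j)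
        ((p.s : ℝ) ^ 2 * (bin p π j).card * p.binLeft j ^ 2)

/-- The noisy pair count of the light bin is at most `2 p_min s²`. -/
def LightCheck (S : p.Sample) (π : p.Tags) (T : p.Sample) (ν : ℝ) : Prop :=
  (pairCount p S T (lightBin p π) : ℝ) + ν ≤ 2 * p.pMin * (p.s : ℝ) ^ 2

/-- One execution of the protocol: the first sample `S` and the prover's tags, then the two
samples `T, T'` and the noise. -/
abbrev Run : Type := (p.Sample × p.Tags) × (p.Sample × p.Sample) × p.Noise

/-- The verifier accepts, i.e. none of its tests fails. -/
def Accepts (ω : Run p) : Prop :=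
  let S := ω.1.1
  let π := ω.1.2
  let T := ω.2.1.1
  let T' := ω.2.1.2
  SeedCheck p S ∧ FormatCheck p π ∧ PTRCheck p S T T' ω.2.2.1 ∧
    BinCheck p S π T T' ω.2.2.2.1 ω.2.2.2.2.1 ∧ LightCheck p S π T ω.2.2.2.2.2

/-- The mass `D(x)` as a real number. -/
def mass {N : ℕ} (D : PMF (Fin N)) (x : Fin N) : ℝ := (D x).toReal

/-- The law of `s` i.i.d. samples from `D`. -/
def sampleLaw (D : PMF (Fin p.N)) : Measure p.Sample :=
  Measure.pi fun _ => D.toMeasure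

/-- The law of `s` i.i.d. uniform elements of the domain. -/
def seedLaw : Measure p.Sample :=
  Measure.pi fun _ => uniformOn Set.univ

/-- The law of the (independent) Laplace noises: scale `1/ε` for the propose-test-release
test, `3/ε` for each pair count, `3Δ/ε` for each triple count, `3/ε` for the light pair
count. -/
def noiseLaw : Measure p.Noise :=
  (laplaceMeasure (1 / p.ε)).prod
    ((Measure.pi fun _ => laplaceMeasure (3 / p.ε)).prod
      ((Measure.pi fun _ => laplaceMeasure (3 * p.Delta / p.ε)).prod
        (laplaceMeasure (3 / p.ε))))

/-- A (possibly randomized, computationally unbounded) prover strategy: the law of the tags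
given the message `S`. -/
abbrev Prover : Type := Kernel p.Sample p.Tags

/-- The honest prover tags `S_i` with `D(S_i)` if this is at least `p_min`, and with `0`
otherwise. -/
def honestProver (D : PMF (Fin p.N)) : Prover p :=
  Kernel.deterministic
    (fun S i => if p.pMin ≤ mass D (S i) then mass D (S i) else 0) .of_discrete

/-- The law of an execution with samples from `D` and prover `P`. The samples `T, T'` and the
noise are independent of the interaction. -/
def runLaw (D : PMF (Fin p.N)) (P : Prover p) : Measure (Run p) :=
  (seedLaw p ⊗ₘ P).prod (((sampleLaw p D).prod (sampleLaw p D)).prod (noiseLaw p))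

/-- Average relative error of the tags over the indices tagged at least `σ/N`. (If `π_i > 0`
and `D(S_i) = 0`, the summand is `1`.) -/
def heavyError (D : PMF (Fin p.N)) (S : p.Sample) (π : p.Tags) : ℝ :=
  1 / p.s * ∑ i ∈ Finset.univ.filter (fun i => p.σ / p.N ≤ π i),
    (1 - min (π i / mass D (S i)) (mass D (S i) / π i))

/-- Normalized mass of the elements tagged below `σ/N`. -/
def lightMass (D : PMF (Fin p.N)) (S : p.Sample) (π : p.Tags) : ℝ :=
  1 / p.s * ∑ i ∈ Finset.univ.filter (fun i => π i < p.σ / p.N), mass D (S i)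

/-- The size `(N/ε)^{2/3} (log N)^a (log(1/δ)/σ)^k`. -/
def sampleScale (a k : ℕ) (N : ℕ) (ε δ σ : ℝ) : ℝ :=
  (N / ε) ^ (2 / 3 : ℝ) * Real.log N ^ a * (Real.log (1 / δ) / σ) ^ k

end TaggedSample

end

noncomputable section

/-! ### The Laplace distribution -/

/-! Fix the seed `S`, in which no element occurs more than three times, and the tags. The samples
`T`, `T'` and the noise are independent of both, so over a set `I` of indices the pair count has
mean `s ∑ D(S_k)` and the triple count has mean `s² ∑ D(S_k)²`: the tests measure the first two
moments of `D` on each bin.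

Both moments matching the claim forces a small error. If a bin with left end `b` has `n` elements
and its moments equal `n b` and `n b²` up to relative error `O(τ)`, then `∑ (D(S_k) - b)² = O(τ n
b²)`. With `τ = σ³`, an AM-GM split with weight `σ` bounds the average relative error by `O(σ)`
(`Regular.sum_relErr_bin_le`). Bins with fewer than `b_min` elements are not tested, but there are
at most `3B` of them and together they hold `O(σ s)` indices (`Regular.heavyError_le`). The zero
tags are controlled by their pair count alone (`Regular.lightMass_le`).

Concentration is Chebyshev plus Laplace tails (`Regular.not_concentrated_le`). Multiplicities at
most three make the variances comparable to the means, up to a factor `1 + 2 s p_max` for triples.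
The scarcest count is the triple count of a bin with `b_min` elements near `p_min`, of order `s³σ³ /
(B N²)`; requiring it to beat `τ⁻²` times the number of bins and the noise gives `s³ ≳ N²/ε²` up to
logarithms and powers of `1/σ`, hence the exponent `2/3`.

Completeness uses the same concentration event, together with a Chernoff bound for the collision
test and a birthday bound for the seed. A prover can make the tags depend on `S` arbitrarily, but
only finitely many partitions into bins exist and the concentration bound is uniform over them, so
averaging over the interaction costs nothing (`prod_setOf_mem_le`). -/

theorem lintegral_exp_mul_Ioi {b : ℝ} (hb : 0 < b) (t : ℝ) :
    ∫⁻ x in Set.Ioi t, ENNReal.ofReal (Real.exp (-x / b) / (2 * b))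
      = ENNReal.ofReal (Real.exp (-t / b) / 2) := by
  have ha : -1 / b < 0 := div_neg_of_neg_of_pos (by norm_num) hb
  have hfun : (fun x : ℝ => Real.exp (-x / b) / (2 * b))
      = fun x => (2 * b)⁻¹ * Real.exp (-1 / b * x) := by
    funext x; rw [div_eq_inv_mul]; congr 2; ring
  rw [← ofReal_integral_eq_lintegral_ofReal, hfun, integral_const_mul, integral_exp_mul_Ioi ha]
  · congr 1
    have : -1 / b * t = -t / b := by ring
    rw [this]; field_simp
  · rw [hfun]; exact (integrableOn_exp_mul_Ioi ha t).const_mul _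
  · exact Eventually.of_forall fun x => by positivity

theorem laplaceMeasure_Ioi {b t : ℝ} (hb : 0 < b) (ht : 0 ≤ t) :
    laplaceMeasure b (Set.Ioi t) = ENNReal.ofReal (Real.exp (-t / b) / 2) := by
  rw [laplaceMeasure, withDensity_apply _ measurableSet_Ioi, ← lintegral_exp_mul_Ioi hb t]
  refine setLIntegral_congr_fun measurableSet_Ioi fun x hx => ?_
  have : (0 : ℝ) ≤ x := ht.trans (le_of_lt hx)
  simp only [abs_of_nonneg this]

theorem laplaceMeasure_Iio_neg {b t : ℝ} (hb : 0 < b) (ht : 0 ≤ t) :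
    laplaceMeasure b (Set.Iio (-t)) = ENNReal.ofReal (Real.exp (-t / b) / 2) := by
  rw [← laplaceMeasure_Ioi hb ht, laplaceMeasure, withDensity_apply _ measurableSet_Ioi,
    withDensity_apply _ measurableSet_Iio]
  have := (Measure.measurePreserving_neg (volume : Measure ℝ)).setLIntegral_comp_emb
    (MeasurableEquiv.neg ℝ).measurableEmbedding
    (fun x => ENNReal.ofReal (Real.exp (-|x| / b) / (2 * b))) (Set.Ioi t)
  simp only [abs_neg] at this
  rw [this]
  congr 2
  simp

theorem laplaceMeasure_abs_gt_le {b t : ℝ} (hb : 0 < b) (ht : 0 ≤ t) :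
    laplaceMeasure b {x | t < |x|} ≤ ENNReal.ofReal (Real.exp (-t / b)) := by
  have hsub : {x : ℝ | t < |x|} ⊆ Set.Ioi t ∪ Set.Iio (-t) := by
    intro x hx
    rw [Set.mem_ofPred_eq] at hx
    rcases lt_abs.1 hx with h | h
    · exact Or.inl h
    · exact Or.inr (by simp only [Set.mem_Iio]; linarith)
  refine (measure_mono hsub).trans ((measure_union_le _ _).trans ?_)
  rw [laplaceMeasure_Ioi hb ht, laplaceMeasure_Iio_neg hb ht,
    ← ENNReal.ofReal_add (by positivity) (by positivity)]
  exact ENNReal.ofReal_le_ofReal (by linarith)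

/-- The tail bound `P(|ν| > t) ≤ b / t` for Laplace noise `ν` of scale `b`. -/
theorem laplaceMeasure_abs_gt_le_div {b t : ℝ} (hb : 0 < b) (ht : 0 < t) :
    laplaceMeasure b {x | t < |x|} ≤ ENNReal.ofReal (b / t) := by
  refine (laplaceMeasure_abs_gt_le hb ht.le).trans (ENNReal.ofReal_le_ofReal ?_)
  have h1 := Real.add_one_le_exp (t / b)
  rw [neg_div, Real.exp_neg, ← inv_div t b]
  exact inv_anti₀ (by positivity) (by linarith)

theorem isProbabilityMeasure_laplaceMeasure {b : ℝ} (hb : 0 < b) :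
    IsProbabilityMeasure (laplaceMeasure b) := by
  constructor
  have hU : (Set.univ : Set ℝ) = Set.Ioi 0 ∪ Set.Iic 0 := by
    ext x; simp
  have hd : Disjoint (Set.Ioi (0 : ℝ)) (Set.Iic 0) :=
    Set.disjoint_left.2 fun x h1 h2 => not_lt.2 (Set.mem_Iic.1 h2) (Set.mem_Ioi.1 h1)
  have h0 : laplaceMeasure b (Set.Iic 0) = laplaceMeasure b (Set.Iio 0) := by
    rw [laplaceMeasure, withDensity_apply _ measurableSet_Iic,
      withDensity_apply _ measurableSet_Iio, setLIntegral_congr Iio_ae_eq_Iic]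
  rw [hU, measure_union hd measurableSet_Iic, h0, laplaceMeasure_Ioi hb le_rfl]
  have := laplaceMeasure_Iio_neg hb le_rfl
  rw [neg_zero] at this
  rw [this, ← ENNReal.ofReal_add (by positivity) (by positivity)]
  norm_num

/-! ### Product measures and finite-valued maps -/

/-- A union bound over the values of a map into a finite type: no measurability of the sets `G e`
is needed. -/
theorem prod_setOf_mem_le {X Y E : Type*} [MeasurableSpace X] [MeasurableSpace Y] [Fintype E]
    (μ : Measure X) [IsProbabilityMeasure μ] (ν : Measure Y) [SFinite ν]
    (f : X → E) (hf : ∀ e, MeasurableSet (f ⁻¹' {e})) (G : E → Set Y) (q : ENNReal)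
    (hG : ∀ e, ν (G e) ≤ q) :
    (μ.prod ν) {z | z.2 ∈ G (f z.1)} ≤ q := by
  have hsub : {z : X × Y | z.2 ∈ G (f z.1)} ⊆ ⋃ e, (f ⁻¹' {e}) ×ˢ G e := by
    intro z hz
    exact Set.mem_iUnion.2 ⟨f z.1, by simp, hz⟩
  calc (μ.prod ν) {z | z.2 ∈ G (f z.1)}
      ≤ ∑ e, (μ.prod ν) ((f ⁻¹' {e}) ×ˢ G e) :=
        (measure_mono hsub).trans (measure_iUnion_fintype_le _ _)
    _ ≤ ∑ e, μ (f ⁻¹' {e}) * q := by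
        refine Finset.sum_le_sum fun e _ => ?_
        rw [Measure.prod_prod]
        gcongr
        exact hG e
    _ = q := by
        rw [← Finset.sum_mul, ← measure_biUnion_finset]
        · have : (⋃ e ∈ (Finset.univ : Finset E), f ⁻¹' {e}) = Set.univ := by
            ext x; simp
          rw [this, measure_univ, one_mul]
        · intro a _ b _ hab
          exact Set.disjoint_left.2 fun x hx hy => hab (hx.symm.trans hy)
        · exact fun e _ => hf e

theorem prod_fst_mem {X Y : Type*} [MeasurableSpace X] [MeasurableSpace Y]
    (μ : Measure X) [SFinite μ] (ν : Measure Y) [IsProbabilityMeasure ν] (A : Set X) :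
    (μ.prod ν) {z | z.1 ∈ A} = μ A := by
  have : {z : X × Y | z.1 ∈ A} = A ×ˢ Set.univ := by ext; simp
  rw [this, Measure.prod_prod, measure_univ, mul_one]

/-- Subadditivity alone suffices, so `A` need not be measurable; this spares a measurability proof
for the acceptance events. -/
theorem one_sub_le_of_compl_le {X : Type*} [MeasurableSpace X] (μ : Measure X)
    [IsProbabilityMeasure μ] (A : Set X) (q r : ENNReal) (h : μ Aᶜ ≤ q) (hq : q + r = 1)
    (hqt : q ≠ ⊤) : r ≤ μ A := by
  have h1 : (1 : ENNReal) ≤ μ A + q := by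
    have := measure_union_le (μ := μ) A Aᶜ
    rw [Set.union_compl_self, measure_univ] at this
    exact this.trans (by gcongr)
  rw [← hq, add_comm q r] at h1
  exact (ENNReal.add_le_add_iff_right hqt).1 h1

namespace TaggedSample

variable (p : Params)

/-! ### Moments of i.i.d. samples -/

theorem mass_nonneg {N : ℕ} (D : PMF (Fin N)) (x : Fin N) : 0 ≤ mass D x := ENNReal.toReal_nonneg

theorem sum_mass {N : ℕ} (D : PMF (Fin N)) : ∑ x, mass D x = 1 := by
  have h := D.tsum_coe
  rw [tsum_fintype] at h
  simp only [mass]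
  rw [← ENNReal.toReal_sum (fun x _ => D.apply_ne_top x), h, ENNReal.toReal_one]

theorem integral_toMeasure {N : ℕ} (D : PMF (Fin N)) (f : Fin N → ℝ) :
    ∫ x, f x ∂D.toMeasure = ∑ x, mass D x * f x := by
  simp [PMF.integral_eq_sum, mass]

instance (D : PMF (Fin p.N)) : IsProbabilityMeasure (sampleLaw p D) := by
  unfold sampleLaw; infer_instance

theorem memLp_of_finite {Ω : Type*} [Finite Ω] [MeasurableSpace Ω] [DiscreteMeasurableSpace Ω]
    (μ : Measure Ω) [IsFiniteMeasure μ] (f : Ω → ℝ) : MemLp f 2 μ := by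
  have hm : AEStronglyMeasurable f μ := (measurable_of_finite f).aestronglyMeasurable
  exact (memLp_two_iff_integrable_sq hm).2 (Integrable.of_finite)

theorem integral_sum_sampleLaw (D : PMF (Fin p.N)) (g : Fin p.N → ℝ) :
    ∫ T, ∑ r, g (T r) ∂sampleLaw p D = p.s * ∑ x, mass D x * g x := by
  rw [integral_finsetSum _ fun i _ => Integrable.of_finite, sampleLaw]
  have : ∀ i : Fin p.s, ∫ T : p.Sample, g (T i) ∂(Measure.pi fun _ => D.toMeasure)
      = ∑ x, mass D x * g x := by
    intro i
    rw [integral_comp_eval (μ := fun _ : Fin p.s => D.toMeasure)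
      (measurable_of_finite g).aestronglyMeasurable, integral_toMeasure]
  simp [this]

theorem variance_sum_sampleLaw_le (D : PMF (Fin p.N)) (g : Fin p.N → ℝ) :
    Var[fun T => ∑ r, g (T r); sampleLaw p D] ≤ p.s * ∑ x, mass D x * g x ^ 2 := by
  have h := variance_sum_pi (μ := fun _ : Fin p.s => D.toMeasure) (X := fun _ => g)
    fun _ => memLp_of_finite _ _
  have hf : (∑ i : Fin p.s, fun ω : p.Sample => g (ω i)) = fun T => ∑ r, g (T r) := by
    funext T; simp
  rw [hf] at h
  rw [sampleLaw, h]
  have hv : Var[g; D.toMeasure] ≤ ∑ x, mass D x * g x ^ 2 := by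
    refine (variance_le_expectation_sq (measurable_of_finite g).aestronglyMeasurable).trans ?_
    rw [integral_toMeasure]; simp
  simp only [Finset.sum_const, Finset.card_univ, Fintype.card_fin, nsmul_eq_mul]
  gcongr

/-- Chebyshev's inequality for a sum over i.i.d. samples. -/
theorem sampleLaw_deviation_le (D : PMF (Fin p.N)) (g : Fin p.N → ℝ) {t : ℝ} (ht : 0 < t) :
    sampleLaw p D {T | t ≤ |∑ r, g (T r) - p.s * ∑ x, mass D x * g x|}
      ≤ ENNReal.ofReal (p.s * (∑ x, mass D x * g x ^ 2) / t ^ 2) := by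
  have h := meas_ge_le_variance_div_sq
    (memLp_of_finite (sampleLaw p D) fun T : p.Sample => ∑ r, g (T r)) ht
  rw [integral_sum_sampleLaw] at h
  refine h.trans (ENNReal.ofReal_le_ofReal ?_)
  gcongr
  exact variance_sum_sampleLaw_le p D g

/-- Number of occurrences of `x` in `T`, as a real number. -/
def occ (T : p.Sample) (x : Fin p.N) : ℝ := ∑ r, if T r = x then (1 : ℝ) else 0

theorem integral_occ_sq_le (D : PMF (Fin p.N)) (x : Fin p.N) :
    ∫ T, occ p T x ^ 2 ∂sampleLaw p D ≤ p.s * mass D x + (p.s * mass D x) ^ 2 := by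
  have hv := variance_sum_sampleLaw_le p D fun y => if y = x then (1 : ℝ) else 0
  have hm := integral_sum_sampleLaw p D fun y => if y = x then (1 : ℝ) else 0
  rw [variance_eq_sub (memLp_of_finite _ _), hm] at hv
  simp only [Pi.pow_apply, ite_pow, one_pow, mul_ite, mul_one, mul_zero, ne_eq,
    OfNat.ofNat_ne_zero, not_false_eq_true, zero_pow, Finset.sum_ite_eq', Finset.mem_univ,
    if_true] at hv
  unfold occ
  linarith

end TaggedSample
end

noncomputable section
namespace TaggedSample

variable (p : Params)

/-! ### Concentration of the pair and triple counts -/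

/-- The multiplicity of `x` among the elements `S_k` with `k ∈ I`. -/
def wt (S : p.Sample) (I : Finset (Fin p.s)) (x : Fin p.N) : ℝ :=
  ∑ k ∈ I, if S k = x then (1 : ℝ) else 0

/-- The sum of `D(S_k)` over `k ∈ I`. -/
def moment₁ (D : PMF (Fin p.N)) (S : p.Sample) (I : Finset (Fin p.s)) : ℝ :=
  ∑ k ∈ I, mass D (S k)

/-- The sum of `D(S_k)²` over `k ∈ I`. -/
def moment₂ (D : PMF (Fin p.N)) (S : p.Sample) (I : Finset (Fin p.s)) : ℝ :=
  ∑ k ∈ I, mass D (S k) ^ 2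

variable {p}

theorem moment₁_nonneg (D : PMF (Fin p.N)) (S : p.Sample) (I : Finset (Fin p.s)) :
    0 ≤ moment₁ p D S I := Finset.sum_nonneg fun _ _ => mass_nonneg _ _

theorem moment₂_nonneg (D : PMF (Fin p.N)) (S : p.Sample) (I : Finset (Fin p.s)) :
    0 ≤ moment₂ p D S I := Finset.sum_nonneg fun _ _ => sq_nonneg _

theorem wt_nonneg (S : p.Sample) (I : Finset (Fin p.s)) (x : Fin p.N) : 0 ≤ wt p S I x :=
  Finset.sum_nonneg fun _ _ => by split_ifs <;> norm_num

theorem wt_le {S : p.Sample} (hS : SeedCheck p S) (I : Finset (Fin p.s)) (x : Fin p.N) :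
    wt p S I x ≤ 3 := by
  have h1 : wt p S I x ≤ ∑ k, if S k = x then (1 : ℝ) else 0 :=
    Finset.sum_le_sum_of_subset_of_nonneg (Finset.subset_univ _) fun _ _ _ => by
      split_ifs <;> norm_num
  refine h1.trans ?_
  rw [Finset.sum_boole]
  exact_mod_cast hS x

/-- This is where the seed check is exploited: bounded multiplicities let second moments of the
weights be replaced by first moments, so variances are of the order of the means. -/
theorem wt_sq_le {S : p.Sample} (hS : SeedCheck p S) (I : Finset (Fin p.s)) (x : Fin p.N) :
    wt p S I x ^ 2 ≤ 3 * wt p S I x := by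
  nlinarith [wt_nonneg S I x, wt_le hS I x]

theorem sum_mul_wt (S : p.Sample) (I : Finset (Fin p.s)) (f : Fin p.N → ℝ) :
    ∑ x, f x * wt p S I x = ∑ k ∈ I, f (S k) := by
  simp only [wt, Finset.mul_sum, mul_ite, mul_one, mul_zero]
  rw [Finset.sum_comm]
  simp

theorem pairCount_eq (S T : p.Sample) (I : Finset (Fin p.s)) :
    (pairCount p S T I : ℝ) = ∑ r, wt p S I (T r) := by
  unfold pairCount wt
  rw [← Finset.sum_boole, ← Finset.univ_product_univ, Finset.sum_product_right]
  refine Finset.sum_congr rfl fun r _ => ?_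
  rw [← Finset.sum_filter_add_sum_filter_not Finset.univ (· ∈ I)]
  simp only [Finset.filter_mem_eq_inter, Finset.univ_inter]
  rw [Finset.sum_eq_zero (s := Finset.filter (· ∉ I) _), add_zero]
  · exact Finset.sum_congr rfl fun k hk => by simp [hk]
  · intro k hk
    simp only [Finset.mem_filter] at hk
    simp [hk.2]

/-- For fixed `T` this exhibits the count as a sum of i.i.d. terms over `T'`, ready for Chebyshev.
-/
theorem tripleCount_eq (S T T' : p.Sample) (I : Finset (Fin p.s)) :
    (tripleCount p S T T' I : ℝ) = ∑ r, wt p S I (T' r) * occ p T (T' r) := by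
  unfold tripleCount wt occ
  rw [← Finset.sum_boole, ← Finset.univ_product_univ, Finset.sum_product_right,
    ← Finset.univ_product_univ, Finset.sum_product_right]
  refine Finset.sum_congr rfl fun r' _ => ?_
  rw [Finset.mul_sum]
  refine Finset.sum_congr rfl fun r _ => ?_
  by_cases h : T r = T' r'
  · simp only [h, and_true, if_true, mul_one]
    rw [← Finset.sum_filter, ← Finset.sum_filter]
    congr 1
    ext k; simp
  · simp [h]

theorem pairCount_deviation_le (D : PMF (Fin p.N)) {S : p.Sample} (hS : SeedCheck p S)
    (I : Finset (Fin p.s)) {t : ℝ} (ht : 0 < t) :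
    sampleLaw p D {T | t ≤ |(pairCount p S T I : ℝ) - p.s * moment₁ p D S I|}
      ≤ ENNReal.ofReal (3 * (p.s * moment₁ p D S I) / t ^ 2) := by
  have h := sampleLaw_deviation_le p D (wt p S I) ht
  have h1 : ∑ x, mass D x * wt p S I x = moment₁ p D S I := sum_mul_wt S I _
  have h2 : ∑ x, mass D x * wt p S I x ^ 2 ≤ 3 * moment₁ p D S I := by
    rw [← h1, Finset.mul_sum]
    refine Finset.sum_le_sum fun x _ => ?_
    nlinarith [wt_sq_le hS I x, mass_nonneg D x]
  simp only [pairCount_eq]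
  rw [h1] at h
  refine h.trans (ENNReal.ofReal_le_ofReal (div_le_div_of_nonneg_right ?_ (sq_nonneg t)))
  nlinarith [mul_le_mul_of_nonneg_left h2 (Nat.cast_nonneg (α := ℝ) p.s)]

theorem sum_occ_mul (T : p.Sample) (f : Fin p.N → ℝ) :
    ∑ x, f x * occ p T x = ∑ r, f (T r) := by
  simp only [occ, Finset.mul_sum, mul_ite, mul_one, mul_zero]
  rw [Finset.sum_comm]
  simp

/-- Deviation of the triple count from its mean over `T'`, for random `T` and `T'`. -/
theorem tripleCount_conditional_deviation_le (D : PMF (Fin p.N)) {S : p.Sample}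
    (hS : SeedCheck p S) (I : Finset (Fin p.s)) {M : ℝ} (hM : ∀ x, mass D x ≤ M)
    {t : ℝ} (ht : 0 < t) :
    ((sampleLaw p D).prod (sampleLaw p D))
        {z | t ≤ |(tripleCount p S z.1 z.2 I : ℝ)
          - p.s * ∑ r, wt p S I (z.1 r) * mass D (z.1 r)|}
      ≤ ENNReal.ofReal (3 * ((p.s : ℝ) ^ 2 * moment₂ p D S I) * (1 + p.s * M) / t ^ 2) := by
  have hmeas : MeasurableSet {z : p.Sample × p.Sample | t ≤ |(tripleCount p S z.1 z.2 I : ℝ)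
          - p.s * ∑ r, wt p S I (z.1 r) * mass D (z.1 r)|} := .of_discrete
  -- Chebyshev over `T'` for each fixed `T`, then integration of the bound over `T`; the second
  -- moment of `occ` contributes the factor `1 + s M`.
  rw [Measure.prod_apply hmeas]
  have hT : ∀ T : p.Sample, sampleLaw p D (Prod.mk T ⁻¹' {z : p.Sample × p.Sample |
      t ≤ |(tripleCount p S z.1 z.2 I : ℝ) - p.s * ∑ r, wt p S I (z.1 r) * mass D (z.1 r)|})
      ≤ ENNReal.ofReal ((p.s : ℝ) * (∑ x, mass D x * (wt p S I x * occ p T x) ^ 2) / t ^ 2) := by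
    intro T
    have h := sampleLaw_deviation_le p D (fun x => wt p S I x * occ p T x) ht
    have h1 : ∑ x, mass D x * (wt p S I x * occ p T x)
        = ∑ r, wt p S I (T r) * mass D (T r) := by
      rw [← sum_occ_mul T fun x => wt p S I x * mass D x]
      exact Finset.sum_congr rfl fun x _ => by ring
    rw [h1] at h
    simpa only [Set.preimage_ofPred_eq, tripleCount_eq] using h
  refine (lintegral_mono hT).trans ?_
  rw [← ofReal_integral_eq_lintegral_ofReal Integrable.of_finite
    (Eventually.of_forall fun T => by
      have : ∀ x, 0 ≤ mass D x := mass_nonneg D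
      exact div_nonneg (mul_nonneg (Nat.cast_nonneg _)
        (Finset.sum_nonneg fun x _ => mul_nonneg (this x) (sq_nonneg _))) (sq_nonneg _))]
  refine ENNReal.ofReal_le_ofReal ?_
  rw [integral_div]
  gcongr
  rw [integral_const_mul, integral_finsetSum _ fun i _ => Integrable.of_finite]
  have hx : ∀ x, ∫ T, mass D x * (wt p S I x * occ p T x) ^ 2 ∂sampleLaw p D
      ≤ 3 * p.s * (1 + p.s * M) * (mass D x ^ 2 * wt p S I x) := by
    intro x
    have h1 := integral_occ_sq_le p D x
    have h0 := mass_nonneg D x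
    have hw := wt_nonneg S I x
    have h2 : ∫ T, occ p T x ^ 2 ∂sampleLaw p D ≤ p.s * mass D x * (1 + p.s * M) := by
      refine h1.trans ?_
      have : p.s * mass D x * (p.s * mass D x) ≤ p.s * mass D x * (p.s * M) := by
        gcongr; exact hM x
      nlinarith
    simp only [mul_pow]
    have h3 : ∀ T : p.Sample, mass D x * (wt p S I x ^ 2 * occ p T x ^ 2)
      = (mass D x * wt p S I x ^ 2) * occ p T x ^ 2 := fun T => by ring
    simp only [h3]
    rw [integral_const_mul]
    have hsM : 0 ≤ p.s * mass D x * (1 + p.s * M) := by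
      have := h0.trans (hM x)
      positivity
    calc mass D x * wt p S I x ^ 2 * ∫ T, occ p T x ^ 2 ∂sampleLaw p D
        ≤ mass D x * (3 * wt p S I x) * (p.s * mass D x * (1 + p.s * M)) := by
          gcongr
          exact wt_sq_le hS I x
      _ = _ := by ring
  calc (p.s : ℝ) * ∑ x, ∫ T, mass D x * (wt p S I x * occ p T x) ^ 2 ∂sampleLaw p D
      ≤ p.s * ∑ x, 3 * p.s * (1 + p.s * M) * (mass D x ^ 2 * wt p S I x) := by
        gcongr with x
        exact hx x
    _ = _ := by
        rw [← Finset.mul_sum, sum_mul_wt S I fun x => mass D x ^ 2, moment₂]; ring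

/-- The deviation splits into that of the count from its conditional mean given `T`, and that of
this conditional mean from its own mean. Each gets `t / 2`; they contribute `12 (1 + s M)` and `12 s
M`. -/
theorem tripleCount_deviation_le (D : PMF (Fin p.N)) {S : p.Sample} (hS : SeedCheck p S)
    (I : Finset (Fin p.s)) {M : ℝ} (hM : ∀ x, mass D x ≤ M) {t : ℝ} (ht : 0 < t) :
    ((sampleLaw p D).prod (sampleLaw p D))
        {z | t ≤ |(tripleCount p S z.1 z.2 I : ℝ) - (p.s : ℝ) ^ 2 * moment₂ p D S I|}
      ≤ ENNReal.ofReal (12 * ((p.s : ℝ) ^ 2 * moment₂ p D S I) * (1 + 2 * p.s * M) / t ^ 2) := by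
  set μ := sampleLaw p D
  rcases (Nat.eq_zero_or_pos p.s) with hs0 | hs0
  · have : {z : p.Sample × p.Sample |
        t ≤ |(tripleCount p S z.1 z.2 I : ℝ) - (p.s : ℝ) ^ 2 * moment₂ p D S I|} = ∅ := by
      ext z
      have hz : (tripleCount p S z.1 z.2 I : ℝ) = 0 := by
        rw [tripleCount_eq]
        have : IsEmpty (Fin p.s) := by rw [hs0]; infer_instance
        simp
      simp only [Set.mem_ofPred_eq, Set.mem_empty_iff_false, iff_false, not_le, hz, hs0]
      simpa using ht
    rw [this]; simp
  have hs : (0 : ℝ) < p.s := by exact_mod_cast hs0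
  have hA := tripleCount_conditional_deviation_le D hS I hM (half_pos ht)
  have hB := sampleLaw_deviation_le p D (fun x => wt p S I x * mass D x)
    (show 0 < t / 2 / p.s by positivity)
  have h1 : ∑ x, mass D x * (wt p S I x * mass D x) = moment₂ p D S I := by
    rw [moment₂, ← sum_mul_wt S I fun x => mass D x ^ 2]
    exact Finset.sum_congr rfl fun x _ => by ring
  rw [h1] at hB
  have hsub : {z : p.Sample × p.Sample |
        t ≤ |(tripleCount p S z.1 z.2 I : ℝ) - (p.s : ℝ) ^ 2 * moment₂ p D S I|} ⊆
      {z | t / 2 ≤ |(tripleCount p S z.1 z.2 I : ℝ)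
          - p.s * ∑ r, wt p S I (z.1 r) * mass D (z.1 r)|} ∪
      {z | z.1 ∈ {T | t / 2 / p.s ≤ |∑ r, wt p S I (T r) * mass D (T r)
          - p.s * moment₂ p D S I|}} := by
    intro z hz
    simp only [Set.mem_ofPred_eq, Set.mem_union] at hz ⊢
    by_contra! hcon
    obtain ⟨h1, h2⟩ := hcon
    rw [lt_div_iff₀ hs, mul_comm, ← abs_of_pos hs, ← abs_mul, abs_of_pos hs] at h2
    rw [abs_lt] at h1 h2
    rcases le_abs.1 hz with h | h <;> nlinarith
  refine (measure_mono hsub).trans ((measure_union_le _ _).trans ?_)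
  rw [prod_fst_mem]
  have hm2 := moment₂_nonneg D S I
  have hM0 : 0 ≤ M := by
    by_contra hneg
    have hall : ∀ x, mass D x < 0 := fun x => (hM x).trans_lt (not_le.1 hneg)
    have := sum_mass D
    have h2 : ∑ x, mass D x ≤ 0 := Finset.sum_nonpos fun x _ => (hall x).le
    linarith
  refine (add_le_add hA hB).trans ?_
  have h3 : ∑ x, mass D x * (wt p S I x * mass D x) ^ 2 ≤ 3 * M * moment₂ p D S I := by
    rw [moment₂, ← sum_mul_wt S I fun x => mass D x ^ 2, Finset.mul_sum]
    refine Finset.sum_le_sum fun x _ => ?_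
    have h0 := mass_nonneg D x
    calc mass D x * (wt p S I x * mass D x) ^ 2
        = mass D x * mass D x ^ 2 * wt p S I x ^ 2 := by ring
      _ ≤ M * mass D x ^ 2 * (3 * wt p S I x) := by
          gcongr
          · exact hM x
          · exact wt_sq_le hS I x
      _ = _ := by ring
  have h4 : 0 ≤ ∑ x, mass D x * (wt p S I x * mass D x) ^ 2 :=
    Finset.sum_nonneg fun x _ => mul_nonneg (mass_nonneg D x) (sq_nonneg _)
  rw [← ENNReal.ofReal_add (by positivity) (by positivity)]
  refine ENNReal.ofReal_le_ofReal ?_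
  have h5 : (p.s : ℝ) * (∑ x, mass D x * (wt p S I x * mass D x) ^ 2) / (t / 2 / p.s) ^ 2
      ≤ p.s * (3 * M * moment₂ p D S I) / (t / 2 / p.s) ^ 2 := by gcongr
  refine (add_le_add_right h5 _).trans (le_of_eq ?_)
  field_simp
  ring

end TaggedSample
end

/-! ### Admissible parameters, expected counts and marginal laws -/

noncomputable section

theorem MeasureTheory.MeasurePreserving.measure_setOf_le {X Y : Type*} [MeasurableSpace X]
    [MeasurableSpace Y] {μ : Measure X} {ν : Measure Y} {f : X → Y} (hf : MeasurePreserving f μ ν)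
    {P : Y → Prop} (hP : MeasurableSet {y | P y}) {q : ENNReal} (h : ν {y | P y} ≤ q) :
    μ {x | P (f x)} ≤ q := by
  rw [← hf.measure_preimage hP.nullMeasurableSet] at h
  exact h

theorem measurableSet_lt_abs (t : ℝ) : MeasurableSet {x : ℝ | t < |x|} :=
  measurableSet_lt measurable_const measurable_id.abs

namespace TaggedSample

variable (p : Params)

/-- The parameters are in the range in which the union bounds succeed. -/
structure Regular : Prop where
  N_pos : 0 < p.N
  ε_pos : 0 < p.ε
  δ_pos : 0 < p.δ
  δ_le : p.δ ≤ 1 / 2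
  σ_pos : 0 < p.σ
  σ_lt : p.σ < 1
  le_s : 200 ≤ (p.s : ℝ)
  s_pow_le : 100 * (p.s : ℝ) ^ 4 ≤ (p.N : ℝ) ^ 3
  one_le_B : 1 ≤ p.B
  main : 864 * p.B ^ 2 * (6192 + (84 + 9600 * Real.log (1 / p.δ) + 60 * p.Delta) / p.ε)
    * (p.N : ℝ) ^ 2 ≤ (p.s : ℝ) ^ 3 * p.σ ^ 9

/-- The law of the samples `T, T'` and of the noise. -/
def testLaw (D : PMF (Fin p.N)) : Measure ((p.Sample × p.Sample) × p.Noise) :=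
  ((sampleLaw p D).prod (sampleLaw p D)).prod (noiseLaw p)

/-- The noisy counts are close to their means. -/
def Concentrated (D : PMF (Fin p.N)) (S : p.Sample) (I : p.bins → Finset (Fin p.s))
    (I₀ : Finset (Fin p.s)) (y : (p.Sample × p.Sample) × p.Noise) : Prop :=
  (∀ j : p.bins, p.bMin ≤ ((I j).card : ℝ) →
    |pairCount p S y.1.1 (I j) + y.2.2.1 j - p.s * moment₁ p D S (I j)|
        ≤ p.tau / 10 * (p.s * moment₁ p D S (I j) + p.s * (I j).card * p.binLeft j) ∧
    |tripleCount p S y.1.1 y.1.2 (I j) + y.2.2.2.1 j - (p.s : ℝ) ^ 2 * moment₂ p D S (I j)|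
        ≤ p.tau / 10 * ((p.s : ℝ) ^ 2 * moment₂ p D S (I j)
          + (p.s : ℝ) ^ 2 * (I j).card * p.binLeft j ^ 2)) ∧
  |pairCount p S y.1.1 I₀ + y.2.2.2.2 - p.s * moment₁ p D S I₀|
    ≤ (p.s * moment₁ p D S I₀ + p.pMin * (p.s : ℝ) ^ 2) / 4

variable {p}

namespace Regular

theorem s_pos (h : Regular p) : (0 : ℝ) < p.s := by linarith [h.le_s]

theorem N_pos' (h : Regular p) : (0 : ℝ) < p.N := by exact_mod_cast h.N_pos

theorem tau_pos (h : Regular p) : 0 < p.tau := pow_pos h.σ_pos 3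

theorem tau_le_one (h : Regular p) : p.tau ≤ 1 := pow_le_one₀ h.σ_pos.le h.σ_lt.le

theorem log_pos (h : Regular p) : 1 / 2 ≤ Real.log (1 / p.δ) := by
  have h1 : (2 : ℝ) ≤ 1 / p.δ := by
    rw [le_div_iff₀ h.δ_pos]; linarith [h.δ_le]
  have := Real.log_le_log (by norm_num) h1
  linarith [Real.log_two_gt_d9]

theorem pMin_pos (h : Regular p) : 0 < p.pMin := div_pos h.σ_pos h.N_pos'

theorem pMax_pos (h : Regular p) : 0 < p.pMax :=
  div_pos (by linarith [h.log_pos]) (mul_pos h.ε_pos h.s_pos)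

theorem Delta_pos (h : Regular p) : 0 < p.Delta := by
  have h1 : 0 ≤ Real.log p.s := Real.log_nonneg (by linarith [h.le_s])
  have h2 : 0 < 5 * Real.log (1 / p.δ) / p.ε :=
    div_pos (by linarith [h.log_pos]) h.ε_pos
  unfold Params.Delta; linarith

theorem s_le_N (h : Regular p) : (p.s : ℝ) ≤ p.N := by
  have h1 := h.s_pow_le
  have h2 := h.le_s
  by_contra hlt
  rw [not_le] at hlt
  have h3 : (p.N : ℝ) ^ 3 ≤ (p.s : ℝ) ^ 3 := by gcongr
  have h4 : (0 : ℝ) < (p.s : ℝ) ^ 3 := pow_pos h.s_pos 3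
  nlinarith

theorem bMin_pos (h : Regular p) : 0 < p.bMin := by
  have := h.one_le_B
  exact mul_pos (div_pos h.σ_pos (by linarith)) h.s_pos

/-- The two end points differ by exactly `B`; rounding and the closed interval cost at most `2`, and
`2 ≤ 2 B`. -/
theorem card_bins_le (h : Regular p) : (p.bins.card : ℝ) ≤ 3 * p.B := by
  have hB := h.one_le_B
  have hN := h.N_pos'
  have hd : Real.log (p.N * p.pMax) / p.tau - Real.log (p.N * p.pMin) / p.tau = p.B := by
    rw [Real.log_mul hN.ne' h.pMax_pos.ne', Real.log_mul hN.ne' h.pMin_pos.ne', Params.B,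
      Real.log_div h.pMax_pos.ne' h.pMin_pos.ne']
    ring
  unfold Params.bins
  set a := Real.log (p.N * p.pMin) / p.tau
  set b := Real.log (p.N * p.pMax) / p.tau
  rw [Int.card_Icc]
  have h1 := Int.lt_floor_add_one a
  have h2 := Int.floor_le b
  have h3 : (0 : ℝ) < (⌊b⌋ + 1 - ⌊a⌋ : ℤ) + 1 := by
    push_cast
    have := Int.lt_floor_add_one b
    have := Int.floor_le a
    linarith
  have h4 : (0 : ℤ) ≤ ⌊b⌋ + 1 - ⌊a⌋ := by
    have : (0 : ℤ) < ⌊b⌋ + 1 - ⌊a⌋ + 1 := by exact_mod_cast h3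
    omega
  have h5 : ((⌊b⌋ + 1 - ⌊a⌋).toNat : ℝ) = ((⌊b⌋ + 1 - ⌊a⌋ : ℤ) : ℝ) := by
    have := Int.toNat_of_nonneg h4
    exact_mod_cast this
  rw [h5]; push_cast
  linarith

theorem binLeft_pos (h : Regular p) (j : ℤ) : 0 < p.binLeft j :=
  div_pos (Real.exp_pos _) h.N_pos'

theorem binLeft_succ (j : ℤ) : p.binLeft (j + 1) = Real.exp p.tau * p.binLeft j := by
  unfold Params.binLeft
  rw [mul_div_assoc', ← Real.exp_add]
  congr 2; push_cast; ring

theorem exp_tau_le (h : Regular p) : Real.exp p.tau ≤ 3 :=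
  (Real.exp_le_exp.2 h.tau_le_one).trans (by linarith [Real.exp_one_lt_d9])

/-- The lowest bin may begin below `p_min`, but by no more than the width `e^τ ≤ 3` of one bin. -/
theorem pMin_le_binLeft (h : Regular p) (j : p.bins) : p.pMin / 3 ≤ p.binLeft j := by
  have h1 := ((p.mem_bins h.N_pos h.σ_pos h.pMax_pos j).1 j.2).2
  rw [binLeft_succ] at h1
  have := h.exp_tau_le
  have := h.binLeft_pos j
  nlinarith

/-- A lower bound for all the expected counts that are tested. -/
theorem count_bounds (h : Regular p) :
    let X := (p.s : ℝ) ^ 3 * p.σ ^ 3 / (18 * p.B * (p.N : ℝ) ^ 2)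
    0 < X ∧ X ≤ p.pMin * (p.s : ℝ) ^ 2 ∧
    (∀ (j : p.bins) (m : ℝ), p.bMin ≤ m → X ≤ p.s * m * p.binLeft j ∧
      X ≤ (p.s : ℝ) ^ 2 * m * p.binLeft j ^ 2) ∧
    3 * p.B * (6192 + (84 + 9600 * Real.log (1 / p.δ) + 60 * p.Delta) / p.ε) / (p.tau ^ 2 * X)
      ≤ 1 / 16 := by
  intro X
  have hs := h.s_pos
  have hN := h.N_pos'
  have hσ := h.σ_pos
  have hB : 0 < p.B := by linarith [h.one_le_B]
  have hX : 0 < X := by positivity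
  have hsN : p.s * p.pMin ≤ 1 := by
    unfold Params.pMin
    rw [mul_div_assoc', div_le_one hN]
    nlinarith [h.s_le_N, h.σ_lt]
  have hb := h.bMin_pos
  have hpm := h.pMin_pos
  -- `X` is the claimed triple count of the smallest tested bin at the lowest possible tag. The pair
  -- scales dominate it because they lack a factor `s p_min ≤ 1`.
  have hXe : X = (p.s : ℝ) ^ 2 * p.bMin * (p.pMin / 3) ^ 2 := by
    simp only [X, Params.bMin, Params.pMin]; field_simp; ring
  have h3 : ∀ (j : p.bins) (m : ℝ), p.bMin ≤ m →
      X ≤ (p.s : ℝ) ^ 2 * m * p.binLeft j ^ 2 := by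
    intro j m hm
    rw [hXe]
    have := h.pMin_le_binLeft j
    have : 0 < m := hb.trans_le hm
    gcongr
  refine ⟨hX, ?_, fun j m hm => ⟨?_, h3 j m hm⟩, ?_⟩
  · have hbs : p.bMin ≤ p.s := by
      unfold Params.bMin
      have : p.σ / (2 * p.B) ≤ 1 := by
        rw [div_le_one (by positivity)]; linarith [h.one_le_B, h.σ_lt]
      nlinarith
    calc X = (p.s : ℝ) * p.bMin * p.pMin * (p.s * p.pMin) / 9 := by rw [hXe]; ring
      _ ≤ (p.s : ℝ) * p.s * p.pMin * 1 / 9 := by gcongr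
      _ ≤ p.pMin * (p.s : ℝ) ^ 2 := by
          have : 0 ≤ p.pMin * (p.s : ℝ) ^ 2 := by positivity
          linarith
  · have := h.pMin_le_binLeft j
    have h1 : 0 < m := hb.trans_le hm
    have h2 := h.binLeft_pos j
    calc X = (p.s : ℝ) * p.bMin * (p.pMin / 3) * (p.s * p.pMin) / 3 := by rw [hXe]; ring
      _ ≤ (p.s : ℝ) * m * p.binLeft j * 1 / 3 := by gcongr
      _ ≤ p.s * m * p.binLeft j := by
          have : 0 ≤ p.s * m * p.binLeft j := by positivity
          linarith
  · have hm := h.main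
    set G := 6192 + (84 + 9600 * Real.log (1 / p.δ) + 60 * p.Delta) / p.ε
    have ht := h.tau_pos
    have e : p.tau ^ 2 * X = (p.s : ℝ) ^ 3 * p.σ ^ 9 / (18 * p.B * (p.N : ℝ) ^ 2) := by
      simp only [X, Params.tau]; ring
    -- After substitution the claim is `54 B² G N² / (s³ σ⁹) ≤ 1/16`, which is `main` with `864 = 16
    -- · 54`.
    rw [e, div_div_eq_mul_div, div_le_iff₀ (by positivity)]
    nlinarith

theorem noise_scale_pos (h : Regular p) : 0 < 3 * p.Delta / p.ε := by
  have := h.Delta_pos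
  have := h.ε_pos
  positivity

theorem isProbabilityMeasure_laplace (h : Regular p) :
    IsProbabilityMeasure (laplaceMeasure (1 / p.ε)) ∧
    IsProbabilityMeasure (laplaceMeasure (3 / p.ε)) ∧
    IsProbabilityMeasure (laplaceMeasure (3 * p.Delta / p.ε)) :=
  ⟨isProbabilityMeasure_laplaceMeasure (one_div_pos.2 h.ε_pos),
    isProbabilityMeasure_laplaceMeasure (div_pos three_pos h.ε_pos),
    isProbabilityMeasure_laplaceMeasure h.noise_scale_pos⟩

theorem isProbabilityMeasure_noiseLaw (h : Regular p) : IsProbabilityMeasure (noiseLaw p) := by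
  obtain ⟨_, _, _⟩ := h.isProbabilityMeasure_laplace
  unfold noiseLaw; infer_instance

theorem isProbabilityMeasure_testLaw (h : Regular p) (D : PMF (Fin p.N)) :
    IsProbabilityMeasure (testLaw p D) := by
  have := h.isProbabilityMeasure_noiseLaw
  unfold testLaw; infer_instance

theorem measurePreserving_samples (h : Regular p) (D : PMF (Fin p.N)) :
    MeasurePreserving (fun y => y.1) (testLaw p D) ((sampleLaw p D).prod (sampleLaw p D)) := by
  have := h.isProbabilityMeasure_noiseLaw
  exact measurePreserving_fst

theorem measurePreserving_noise (h : Regular p) (D : PMF (Fin p.N)) :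
    MeasurePreserving (fun y => y.2.1) (testLaw p D) (laplaceMeasure (1 / p.ε)) ∧
    (∀ j, MeasurePreserving (fun y => y.2.2.1 j) (testLaw p D) (laplaceMeasure (3 / p.ε))) ∧
    (∀ j, MeasurePreserving (fun y => y.2.2.2.1 j) (testLaw p D)
      (laplaceMeasure (3 * p.Delta / p.ε))) ∧
    MeasurePreserving (fun y => y.2.2.2.2) (testLaw p D) (laplaceMeasure (3 / p.ε)) := by
  obtain ⟨_, _, _⟩ := h.isProbabilityMeasure_laplace
  have h0 : MeasurePreserving (fun y => y.2) (testLaw p D) (noiseLaw p) := by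
    have := h.isProbabilityMeasure_noiseLaw
    exact measurePreserving_snd
  have h1 : MeasurePreserving (fun z => z.2) (noiseLaw p) _ := measurePreserving_snd
  have h2 := measurePreserving_snd.comp h1
  exact ⟨measurePreserving_fst.comp h0,
    fun j => ((measurePreserving_eval _ j).comp (measurePreserving_fst.comp h1)).comp h0,
    fun j => ((measurePreserving_eval _ j).comp (measurePreserving_fst.comp h2)).comp h0,
    (measurePreserving_snd.comp h2).comp h0⟩

end Regular

end TaggedSample
end

/-! ### Simultaneous concentration of all noisy counts -/

noncomputable section

/-- A Chebyshev quotient for variance `c m` and deviation `θ (m + W)`. The true mean `m` of a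
dishonest claim `W` may be far smaller or larger than `W`; measuring against `m + W` handles both
cases. -/
theorem mul_div_sq_le {c m W X θ : ℝ} (hc : 0 ≤ c) (hm : 0 ≤ m) (hX : 0 < X) (hXW : X ≤ W)
    (hθ : 0 < θ) : c * m / (θ * (m + W)) ^ 2 ≤ c / (θ ^ 2 * X) := by
  have hW : 0 < W := hX.trans_le hXW
  rw [div_le_div_iff₀ (by positivity) (by positivity)]
  have : m * X ≤ (m + W) ^ 2 := by nlinarith
  calc c * m * (θ ^ 2 * X) = c * θ ^ 2 * (m * X) := by ring
    _ ≤ c * θ ^ 2 * (m + W) ^ 2 := by gcongr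
    _ = _ := by ring

theorem abs_add_le_of_not {a x n m W θ : ℝ} (hm : 0 ≤ m) (hθ : 0 ≤ θ)
    (h1 : ¬ θ * (m + W) ≤ |a - x|) (h2 : ¬ θ * W < |n|) :
    |a + n - x| ≤ 2 * θ * (m + W) := by
  rw [not_le] at h1
  rw [not_lt] at h2
  have h3 : |a + n - x| ≤ |a - x| + |n| := by
    rw [show a + n - x = (a - x) + n by ring]; exact abs_add_le _ _
  nlinarith [mul_nonneg hθ hm]

namespace TaggedSample

variable {p : Params}

/-- With probability at least `15/16` all noisy counts are close to their means. -/
theorem Regular.not_concentrated_le (h : Regular p) (D : PMF (Fin p.N))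
    (hD : ∀ x, mass D x ≤ p.pMax) {S : p.Sample} (hS : SeedCheck p S)
    (I : p.bins → Finset (Fin p.s)) (I₀ : Finset (Fin p.s)) :
    testLaw p D {y | ¬ Concentrated p D S I I₀ y} ≤ ENNReal.ofReal (1 / 16) := by
  obtain ⟨hX, hXY, hXj, hfin⟩ := h.count_bounds
  set X := (p.s : ℝ) ^ 3 * p.σ ^ 3 / (18 * p.B * (p.N : ℝ) ^ 2)
  set Y := p.pMin * (p.s : ℝ) ^ 2
  obtain ⟨-, hn2, hn3, hn4⟩ := h.measurePreserving_noise D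
  have hsam := h.measurePreserving_samples D
  have hfst : MeasurePreserving (fun y : (p.Sample × p.Sample) × p.Noise => y.1.1)
      (testLaw p D) (sampleLaw p D) :=
    (measurePreserving_fst (μ := sampleLaw p D) (ν := sampleLaw p D)).comp hsam
  have ht := h.tau_pos
  have ht1 := h.tau_le_one
  have hε := h.ε_pos
  have hs := h.s_pos
  have hL := h.log_pos
  have hΔ := h.Delta_pos
  have hB := h.one_le_B
  -- Half of the tolerance `τ / 10` goes to sampling and half to the noise.
  set θ := p.tau / 20 with hθdef
  have hθ : 0 < θ := by positivity
  set m₁ := fun J => p.s * moment₁ p D S J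
  set m₂ := fun J => (p.s : ℝ) ^ 2 * moment₂ p D S J
  have hm₁ : ∀ J, 0 ≤ m₁ J := fun J => mul_nonneg hs.le (moment₁_nonneg D S J)
  have hm₂ : ∀ J, 0 ≤ m₂ J := fun J => mul_nonneg (by positivity) (moment₂_nonneg D S J)
  set W₁ := fun j : p.bins => p.s * ((I j).card : ℝ) * p.binLeft j
  set W₂ := fun j : p.bins => (p.s : ℝ) ^ 2 * (I j).card * p.binLeft j ^ 2
  let A : p.bins → Set ((p.Sample × p.Sample) × p.Noise) := fun j =>
    if p.bMin ≤ ((I j).card : ℝ) then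
      ({y | θ * (m₁ (I j) + W₁ j) ≤ |(pairCount p S y.1.1 (I j) : ℝ) - m₁ (I j)|} ∪
        {y | θ * W₁ j < |y.2.2.1 j|}) ∪
      ({y | θ * (m₂ (I j) + W₂ j) ≤ |(tripleCount p S y.1.1 y.1.2 (I j) : ℝ) - m₂ (I j)|} ∪
        {y | θ * W₂ j < |y.2.2.2.1 j|})
    else ∅
  let A₀ : Set ((p.Sample × p.Sample) × p.Noise) :=
      {y | 1 / 8 * (m₁ I₀ + Y) ≤ |(pairCount p S y.1.1 I₀ : ℝ) - m₁ I₀|} ∪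
        {y | 1 / 8 * Y < |y.2.2.2.2|}
  have hsub : {y | ¬ Concentrated p D S I I₀ y} ⊆ (⋃ j, A j) ∪ A₀ := by
    intro y hy
    simp only [Set.mem_ofPred_eq] at hy
    by_contra hcon
    apply hy
    simp only [Set.mem_union, Set.mem_iUnion, not_or, not_exists] at hcon
    obtain ⟨hA, hA0⟩ := hcon
    constructor
    · intro j hj
      have := hA j
      simp only [A, if_pos hj, Set.mem_union, Set.mem_ofPred_eq, not_or] at this
      obtain ⟨⟨a1, a2⟩, a3, a4⟩ := this
      have e : p.tau / 10 = 2 * θ := by rw [hθdef]; ring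
      rw [e]
      exact ⟨abs_add_le_of_not (hm₁ _) hθ.le a1 a2, abs_add_le_of_not (hm₂ _) hθ.le a3 a4⟩
    · simp only [A₀, Set.mem_union, Set.mem_ofPred_eq, not_or] at hA0
      have := abs_add_le_of_not (hm₁ I₀) (by norm_num : (0 : ℝ) ≤ 1 / 8) hA0.1 hA0.2
      refine this.trans (le_of_eq ?_)
      simp only [m₁, Y]; ring
  have hpair : ∀ (J : Finset (Fin p.s)) (η W : ℝ), 0 < η → X ≤ W →
      testLaw p D {y | η * (m₁ J + W) ≤ |(pairCount p S y.1.1 J : ℝ) - m₁ J|}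
        ≤ ENNReal.ofReal (3 / (η ^ 2 * X)) := by
    intro J η W hη hW
    have hpos : 0 < η * (m₁ J + W) := mul_pos hη (by linarith [hm₁ J])
    refine hfst.measure_setOf_le (P := fun T : p.Sample =>
      η * (m₁ J + W) ≤ |(pairCount p S T J : ℝ) - m₁ J|) .of_discrete ?_
    exact (pairCount_deviation_le D hS J hpos).trans (ENNReal.ofReal_le_ofReal
      (mul_div_sq_le (by norm_num) (hm₁ J) hX hW hη))
  have htriple : ∀ (J : Finset (Fin p.s)) (η W : ℝ), 0 < η → X ≤ W →
      testLaw p D {y | η * (m₂ J + W) ≤ |(tripleCount p S y.1.1 y.1.2 J : ℝ) - m₂ J|}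
        ≤ ENNReal.ofReal (12 * (1 + 2 * p.s * p.pMax) / (η ^ 2 * X)) := by
    intro J η W hη hW
    have hpos : 0 < η * (m₂ J + W) := mul_pos hη (by linarith [hm₂ J])
    refine hsam.measure_setOf_le (P := fun T : p.Sample × p.Sample =>
      η * (m₂ J + W) ≤ |(tripleCount p S T.1 T.2 J : ℝ) - m₂ J|) .of_discrete ?_
    refine (tripleCount_deviation_le D hS J hD hpos).trans (ENNReal.ofReal_le_ofReal ?_)
    have hpm := h.pMax_pos
    have := mul_div_sq_le (c := 12 * (1 + 2 * p.s * p.pMax)) (by positivity) (hm₂ J) hX hW hη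
    refine le_trans (le_of_eq ?_) this
    simp only [m₂]; ring
  have hnoise : ∀ (b η W : ℝ), 0 < b → 0 < η → X ≤ W →
      laplaceMeasure b {x | η * W < |x|} ≤ ENNReal.ofReal (b / (η * X)) := by
    intro b η W hb hη hW
    refine (laplaceMeasure_abs_gt_le_div hb (mul_pos hη (hX.trans_le hW))).trans
      (ENNReal.ofReal_le_ofReal ?_)
    gcongr
  set q : ℝ := (3 / (θ ^ 2 * X) + 3 / p.ε / (θ * X)) +
    (12 * (1 + 2 * p.s * p.pMax) / (θ ^ 2 * X) + 3 * p.Delta / p.ε / (θ * X))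
  set q₀ : ℝ := 3 / ((1 / 8) ^ 2 * X) + 3 / p.ε / (1 / 8 * X)
  have hpM := h.pMax_pos
  have hq : 0 ≤ q := by positivity
  have hq₀ : 0 ≤ q₀ := by positivity
  have hb3 : 0 < 3 / p.ε := by positivity
  have hAj : ∀ j, testLaw p D (A j) ≤ ENNReal.ofReal q := by
    intro j
    by_cases hj : p.bMin ≤ ((I j).card : ℝ)
    · simp only [A, if_pos hj]
      obtain ⟨hW1, hW2⟩ := hXj j _ hj
      rw [ENNReal.ofReal_add (by positivity) (by positivity),
        ENNReal.ofReal_add (by positivity) (by positivity),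
        ENNReal.ofReal_add (by positivity) (by positivity)]
      refine (measure_union_le _ _).trans (add_le_add ((measure_union_le _ _).trans
        (add_le_add (hpair _ _ _ hθ hW1) ?_)) ((measure_union_le _ _).trans
        (add_le_add (htriple _ _ _ hθ hW2) ?_)))
      · exact (hn2 j).measure_setOf_le (P := fun x => θ * W₁ j < |x|) (measurableSet_lt_abs _)
          (hnoise _ _ _ hb3 hθ hW1)
      · exact (hn3 j).measure_setOf_le (P := fun x => θ * W₂ j < |x|) (measurableSet_lt_abs _)
          (hnoise _ _ _ h.noise_scale_pos hθ hW2)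
    · simp only [A, if_neg hj, measure_empty, zero_le]
  have hA₀ : testLaw p D A₀ ≤ ENNReal.ofReal q₀ := by
    rw [ENNReal.ofReal_add (by positivity) (by positivity)]
    exact (measure_union_le _ _).trans (add_le_add (hpair _ _ _ (by norm_num) hXY)
      (hn4.measure_setOf_le (P := fun x => 1 / 8 * Y < |x|) (measurableSet_lt_abs _)
        (hnoise _ _ _ hb3 (by norm_num) hXY)))
  have htot : (p.bins.card : ℝ) * q + q₀ ≤ 1 / 16 := by
    refine le_trans ?_ hfin
    have h1 : (p.bins.card : ℝ) * q + q₀ ≤ 3 * p.B * (q + q₀) := by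
      have := h.card_bins_le
      nlinarith
    refine h1.trans ?_
    rw [mul_div_assoc]
    refine mul_le_mul_of_nonneg_left ?_ (by linarith)
    rw [le_div_iff₀ (by positivity)]
    have hsp : p.s * p.pMax = Real.log (1 / p.δ) / p.ε := by
      unfold Params.pMax; field_simp
    -- The bins give `1200 = 3 · 20²` (pairs), `4800 = 12 · 20²` (triples) and `60 = 3 · 20`
    -- (noise); the light bin, with tolerance `1/8`, gives `192 = 3 · 8²` and `24 = 3 · 8`.
    have e : (q + q₀) * (p.tau ^ 2 * X) = 1200 + 60 / p.ε * p.tau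
        + 4800 * (1 + 2 * (p.s * p.pMax)) + 60 * p.Delta / p.ε * p.tau
        + (192 + 24 / p.ε) * p.tau ^ 2 := by
      simp only [q, q₀, hθdef]; field_simp; ring
    rw [e, hsp]
    have a1 : 60 / p.ε * p.tau ≤ 60 / p.ε * 1 := by gcongr
    have a2 : 60 * p.Delta / p.ε * p.tau ≤ 60 * p.Delta / p.ε * 1 := by gcongr
    have a3 : (192 + 24 / p.ε) * p.tau ^ 2 ≤ (192 + 24 / p.ε) * 1 := by
      gcongr; exact pow_le_one₀ ht.le ht1
    have a4 : (84 + 9600 * Real.log (1 / p.δ) + 60 * p.Delta) / p.ε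
        = 60 / p.ε + 24 / p.ε + 9600 * (Real.log (1 / p.δ) / p.ε) + 60 * p.Delta / p.ε := by
      ring
    rw [a4]; linarith
  calc testLaw p D {y | ¬ Concentrated p D S I I₀ y}
      ≤ ∑ j, testLaw p D (A j) + testLaw p D A₀ :=
        (measure_mono hsub).trans ((measure_union_le _ _).trans
          (add_le_add (measure_iUnion_fintype_le _ _) le_rfl))
    _ ≤ ∑ _j : p.bins, ENNReal.ofReal q + ENNReal.ofReal q₀ :=
        add_le_add (Finset.sum_le_sum fun j _ => hAj j) hA₀
    _ = ENNReal.ofReal (p.bins.card * q + q₀) := by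
        rw [ENNReal.ofReal_add (by positivity) hq₀, ENNReal.ofReal_mul (by positivity)]
        simp
    _ ≤ _ := ENNReal.ofReal_le_ofReal htot

end TaggedSample
end

noncomputable section
namespace TaggedSample

variable {p : Params}

/-! ### The propose-test-release test and the seed -/

/-- Chernoff's bound with exponent `1`, using `e - 1 < 7/4`. -/
theorem occ_tail_le (D : PMF (Fin p.N)) (x : Fin p.N) (t : ℝ) :
    sampleLaw p D {T | t ≤ occ p T x}
      ≤ ENNReal.ofReal (Real.exp (7 / 4 * (p.s * mass D x) - t)) := by
  have h := measure_ge_le_exp_mul_mgf (μ := sampleLaw p D) (X := fun T : p.Sample => occ p T x)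
    (t := 1) t zero_le_one Integrable.of_finite
  rw [← ENNReal.ofReal_toReal (measure_ne_top (sampleLaw p D) _)]
  refine ENNReal.ofReal_le_ofReal (h.trans ?_)
  have h1 : mgf (fun T : p.Sample => occ p T x) (sampleLaw p D) 1
      = (∑ y, mass D y * Real.exp (if y = x then (1 : ℝ) else 0)) ^ p.s := by
    simp only [mgf, one_mul, occ, Real.exp_sum]
    rw [sampleLaw, integral_fintype_prod_eq_pow
      (fun y : Fin p.N => Real.exp (if y = x then (1 : ℝ) else 0)), integral_toMeasure,
      Fintype.card_fin]
  have h2 : ∑ y, mass D y * Real.exp (if y = x then (1 : ℝ) else 0)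
      = 1 + (Real.exp 1 - 1) * mass D x := by
    have : ∀ y, mass D y * Real.exp (if y = x then (1 : ℝ) else 0)
        = mass D y + if y = x then (Real.exp 1 - 1) * mass D x else 0 := by
      intro y
      split_ifs with hy
      · rw [hy]; ring
      · simp
    simp only [this, Finset.sum_add_distrib, sum_mass]
    simp
  have h0 := mass_nonneg D x
  have h3 : 1 + (Real.exp 1 - 1) * mass D x ≤ Real.exp (7 / 4 * mass D x) := by
    have := Real.add_one_le_exp (7 / 4 * mass D x)
    nlinarith [Real.exp_one_lt_d9]
  have h4 : 0 ≤ 1 + (Real.exp 1 - 1) * mass D x := by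
    have := Real.add_one_le_exp (1 : ℝ)
    nlinarith
  rw [h1, h2]
  calc Real.exp (-1 * t) * (1 + (Real.exp 1 - 1) * mass D x) ^ p.s
      ≤ Real.exp (-1 * t) * Real.exp (7 / 4 * mass D x) ^ p.s := by gcongr
    _ = _ := by
        rw [← Real.exp_nat_mul, ← Real.exp_add]; congr 1; ring

theorem card_filter_eq_occ (S T : p.Sample) (k : Fin p.s) :
    ((Finset.univ.filter fun r => S k = T r).card : ℝ) = occ p T (S k) := by
  rw [occ, ← Finset.sum_boole]
  exact Finset.sum_congr rfl fun r _ => by simp [eq_comm]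

theorem exists_occ_of_lt_maxCollision {S T : p.Sample} {t : ℝ}
    (h : t < maxCollision p S T) (ht : 0 ≤ t) : ∃ k, t ≤ occ p T (S k) := by
  by_contra! hcon
  have : maxCollision p S T ≤ ⌊t⌋₊ := by
    refine Finset.sup_le fun k _ => Nat.le_floor ?_
    rw [card_filter_eq_occ]
    exact (hcon k).le
  have h2 : ((maxCollision p S T : ℕ) : ℝ) ≤ t := (Nat.cast_le.2 this).trans (Nat.floor_le ht)
  linarith

namespace Regular

theorem s_mul_pMax (h : Regular p) : p.s * p.pMax = Real.log (1 / p.δ) / p.ε := by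
  have := h.s_pos
  have := h.ε_pos
  unfold Params.pMax; field_simp

/-- Each `S_k` is expected at most `s p_max = log(1/δ)/ε` times, so the Chernoff tail at this
threshold is at most `s⁻²`; the union over `k` leaves `1/s ≤ 1/200`. -/
theorem maxCollision_tail_le (h : Regular p) (D : PMF (Fin p.N)) (hD : ∀ x, mass D x ≤ p.pMax)
    (S : p.Sample) :
    sampleLaw p D {T | 7 / 4 * (Real.log (1 / p.δ) / p.ε) + 2 * Real.log p.s < maxCollision p S T}
      ≤ ENNReal.ofReal (1 / 200) := by
  have hs := h.s_pos
  have hL := h.log_pos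
  have hε := h.ε_pos
  set t := 7 / 4 * (Real.log (1 / p.δ) / p.ε) + 2 * Real.log p.s with ht
  have ht0 : 0 ≤ t := by
    have : 0 ≤ Real.log p.s := Real.log_nonneg (by linarith [h.le_s])
    positivity
  have hsub : {T | t < maxCollision p S T} ⊆ ⋃ k, {T | t ≤ occ p T (S k)} := by
    intro T hT
    simp only [Set.mem_ofPred_eq] at hT
    obtain ⟨k, hk⟩ := exists_occ_of_lt_maxCollision hT ht0
    exact Set.mem_iUnion.2 ⟨k, by simpa using hk⟩
  have hk : ∀ k, sampleLaw p D {T | t ≤ occ p T (S k)}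
      ≤ ENNReal.ofReal (1 / (p.s : ℝ) ^ 2) := by
    intro k
    refine (occ_tail_le D (S k) t).trans (ENNReal.ofReal_le_ofReal ?_)
    have h1 : p.s * mass D (S k) ≤ Real.log (1 / p.δ) / p.ε := by
      rw [← h.s_mul_pMax]; gcongr; exact hD _
    calc Real.exp (7 / 4 * (p.s * mass D (S k)) - t) ≤ Real.exp (-(2 * Real.log p.s)) :=
          Real.exp_le_exp.2 (by rw [ht]; linarith)
      _ = 1 / (p.s : ℝ) ^ 2 := by
          rw [Real.exp_neg, two_mul, Real.exp_add, Real.exp_log hs, one_div, sq]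
  calc _ ≤ ∑ k, sampleLaw p D {T | t ≤ occ p T (S k)} :=
        (measure_mono hsub).trans (measure_iUnion_fintype_le _ _)
    _ ≤ ∑ _k : Fin p.s, ENNReal.ofReal (1 / (p.s : ℝ) ^ 2) := Finset.sum_le_sum fun k _ => hk k
    _ = ENNReal.ofReal (p.s * (1 / (p.s : ℝ) ^ 2)) := by
        rw [ENNReal.ofReal_mul hs.le]; simp
    _ ≤ _ := by
        refine ENNReal.ofReal_le_ofReal ?_
        rw [show (p.s : ℝ) * (1 / (p.s : ℝ) ^ 2) = 1 / p.s by field_simp]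
        exact one_div_le_one_div_of_le (by norm_num) h.le_s

theorem ptr_noise_tail_le (h : Regular p) :
    laplaceMeasure (1 / p.ε) {x | 2 * (Real.log (1 / p.δ) / p.ε) < x}
      ≤ ENNReal.ofReal (1 / 8) := by
  have hL := h.log_pos
  have hε := h.ε_pos
  have hδ := h.δ_pos
  have e := laplaceMeasure_Ioi (b := 1 / p.ε) (t := 2 * (Real.log (1 / p.δ) / p.ε))
    (by positivity) (by positivity)
  refine (le_of_eq e).trans (ENNReal.ofReal_le_ofReal ?_)
  have e2 : -(2 * (Real.log (1 / p.δ) / p.ε)) / (1 / p.ε) = Real.log p.δ + Real.log p.δ := by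
    rw [one_div, Real.log_inv]; field_simp; ring
  rw [e2, Real.exp_add, Real.exp_log hδ]
  nlinarith [h.δ_le]

/-- The collision threshold plus `2 log(1/δ)/ε` for noise stays below `3 log s + 4 log(1/δ)/ε`, the
cutoff of the test. The failure probabilities are `1/200` for each sample and `δ²/2 ≤ 1/8` for the
noise. -/
theorem not_ptrCheck_le (h : Regular p) (D : PMF (Fin p.N)) (hD : ∀ x, mass D x ≤ p.pMax)
    (S : p.Sample) :
    testLaw p D {y | ¬ PTRCheck p S y.1.1 y.1.2 y.2.1} ≤ ENNReal.ofReal (27 / 200) := by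
  have hL := h.log_pos
  have hε := h.ε_pos
  set t := 7 / 4 * (Real.log (1 / p.δ) / p.ε) + 2 * Real.log p.s with ht
  have hls : 0 ≤ Real.log p.s := Real.log_nonneg (by linarith [h.le_s])
  have hLε : 0 < Real.log (1 / p.δ) / p.ε := by positivity
  obtain ⟨hn, -⟩ := h.measurePreserving_noise D
  have hsam := h.measurePreserving_samples D
  have h1 : MeasurePreserving (fun y : (p.Sample × p.Sample) × p.Noise => y.1.1)
      (testLaw p D) (sampleLaw p D) :=
    (measurePreserving_fst (μ := sampleLaw p D) (ν := sampleLaw p D)).comp hsam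
  have h2 : MeasurePreserving (fun y : (p.Sample × p.Sample) × p.Noise => y.1.2)
      (testLaw p D) (sampleLaw p D) :=
    (measurePreserving_snd (μ := sampleLaw p D) (ν := sampleLaw p D)).comp hsam
  have hsub : {y : (p.Sample × p.Sample) × p.Noise | ¬ PTRCheck p S y.1.1 y.1.2 y.2.1} ⊆
      ({y | t < maxCollision p S y.1.1} ∪ {y | t < maxCollision p S y.1.2}) ∪
      {y | 2 * (Real.log (1 / p.δ) / p.ε) < y.2.1} := by
    intro y hy
    simp only [Set.mem_ofPred_eq, PTRCheck, not_le, Params.Delta] at hy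
    by_contra hcon
    simp only [Set.mem_union, Set.mem_ofPred_eq, not_or, not_lt] at hcon
    obtain ⟨⟨c1, c2⟩, c3⟩ := hcon
    have hmax : ((max (maxCollision p S y.1.1) (maxCollision p S y.1.2) : ℕ) : ℝ) ≤ t := by
      rw [Nat.cast_max]; exact max_le c1 c2
    have : 5 * Real.log (1 / p.δ) / p.ε = 5 * (Real.log (1 / p.δ) / p.ε) := by ring
    linarith
  have hc := h.maxCollision_tail_le D hD S
  refine (measure_mono hsub).trans ((measure_union_le _ _).trans
    ((add_le_add (measure_union_le _ _) le_rfl).trans ?_))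
  have b1 := h1.measure_setOf_le (P := fun T => t < maxCollision p S T) .of_discrete hc
  have b2 := h2.measure_setOf_le (P := fun T => t < maxCollision p S T) .of_discrete hc
  have b3 := hn.measure_setOf_le (P := fun x => 2 * (Real.log (1 / p.δ) / p.ε) < x)
    measurableSet_Ioi h.ptr_noise_tail_le
  refine (add_le_add (add_le_add b1 b2) b3).trans ?_
  rw [← ENNReal.ofReal_add (by norm_num) (by norm_num),
    ← ENNReal.ofReal_add (by norm_num) (by norm_num)]
  exact ENNReal.ofReal_le_ofReal (by norm_num)

theorem nonempty (h : Regular p) : Nonempty (Fin p.N) := ⟨⟨0, h.N_pos⟩⟩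

theorem isProbabilityMeasure_uniformOn (h : Regular p) :
    IsProbabilityMeasure (uniformOn (Set.univ : Set (Fin p.N))) :=
  have := h.nonempty
  ProbabilityTheory.isProbabilityMeasure_uniformOn Set.finite_univ Set.univ_nonempty

theorem isProbabilityMeasure_seedLaw (h : Regular p) : IsProbabilityMeasure (seedLaw p) := by
  have := h.isProbabilityMeasure_uniformOn
  unfold seedLaw; infer_instance

theorem seedLaw_forall_mem_eq (h : Regular p) (J : Finset (Fin p.s)) (x : Fin p.N) :
    seedLaw p {S | ∀ i ∈ J, S i = x} = ENNReal.ofReal ((1 / (p.N : ℝ)) ^ J.card) := by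
  have := h.isProbabilityMeasure_uniformOn
  have e : {S : p.Sample | ∀ i ∈ J, S i = x}
      = Set.pi Set.univ fun i => if i ∈ J then ({x} : Set (Fin p.N)) else Set.univ := by
    ext S
    simp only [Set.mem_ofPred_eq, Set.mem_pi, Set.mem_univ, true_implies]
    refine forall_congr' fun i => ?_
    by_cases hi : i ∈ J <;> simp [hi]
  have hx : uniformOn (Set.univ : Set (Fin p.N)) {x} = ENNReal.ofReal (1 / (p.N : ℝ)) := by
    rw [uniformOn_univ, Measure.count_singleton, Fintype.card_fin, one_div, one_div,
      ENNReal.ofReal_inv_of_pos h.N_pos', ENNReal.ofReal_natCast]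
  rw [e, seedLaw, Measure.pi_pi]
  have : ∀ i, uniformOn (Set.univ : Set (Fin p.N))
      (if i ∈ J then ({x} : Set (Fin p.N)) else Set.univ)
      = if i ∈ J then ENNReal.ofReal (1 / (p.N : ℝ)) else 1 := by
    intro i
    split_ifs
    · exact hx
    · exact measure_univ
  simp only [this]
  rw [Finset.prod_ite, ENNReal.ofReal_pow (by positivity)]
  simp

/-- Birthday bound: a violation makes some four positions agree on some `x`, with total probability
at most `N s⁴ N⁻⁴`. -/
theorem not_seedCheck_le (h : Regular p) :
    seedLaw p {S | ¬ SeedCheck p S} ≤ ENNReal.ofReal (1 / 100) := by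
  have hN := h.N_pos'
  set Js := Finset.powersetCard 4 (Finset.univ : Finset (Fin p.s))
  have hsub : {S | ¬ SeedCheck p S} ⊆
      ⋃ x : Fin p.N, ⋃ J ∈ Js, {S : p.Sample | ∀ i ∈ J, S i = x} := by
    intro S hS
    simp only [Set.mem_ofPred_eq, SeedCheck, not_forall, not_le] at hS
    obtain ⟨x, hx⟩ := hS
    obtain ⟨J, hJ, hcard⟩ := Finset.exists_subset_card_eq (show 4 ≤ _ from hx)
    simp only [Set.mem_iUnion]
    refine ⟨x, J, Finset.mem_powersetCard.2 ⟨Finset.subset_univ _, hcard⟩, ?_⟩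
    simp only [Set.mem_ofPred_eq]
    intro i hi
    exact (Finset.mem_filter.1 (hJ hi)).2
  calc _ ≤ ∑ x : Fin p.N, ∑ J ∈ Js, seedLaw p {S | ∀ i ∈ J, S i = x} :=
        (measure_mono hsub).trans ((measure_iUnion_fintype_le _ _).trans
          (Finset.sum_le_sum fun x _ => measure_biUnion_finset_le _ _))
    _ = ∑ _x : Fin p.N, ∑ _J ∈ Js, ENNReal.ofReal ((1 / (p.N : ℝ)) ^ 4) := by
        refine Finset.sum_congr rfl fun x _ => Finset.sum_congr rfl fun J hJ => ?_
        rw [h.seedLaw_forall_mem_eq, (Finset.mem_powersetCard.1 hJ).2]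
    _ = ENNReal.ofReal (p.N * ((p.s.choose 4 : ℕ) * (1 / (p.N : ℝ)) ^ 4)) := by
        rw [ENNReal.ofReal_mul hN.le, ENNReal.ofReal_mul (Nat.cast_nonneg _)]
        simp [Js]
    _ ≤ _ := by
        refine ENNReal.ofReal_le_ofReal ?_
        have h1 : ((p.s.choose 4 : ℕ) : ℝ) ≤ (p.s : ℝ) ^ 4 := by
          exact_mod_cast Nat.choose_le_pow p.s 4
        have h2 := h.s_pow_le
        calc _ ≤ p.N * ((p.s : ℝ) ^ 4 * (1 / (p.N : ℝ)) ^ 4) := by gcongr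
          _ = (p.s : ℝ) ^ 4 / (p.N : ℝ) ^ 3 := by field_simp
          _ ≤ 1 / 100 := by
            rw [div_le_div_iff₀ (by positivity) (by norm_num)]; linarith

end Regular

end TaggedSample
end

noncomputable section
namespace TaggedSample

variable {p : Params}

/-! ### Consequences of concentration -/

/-- By convexity the exponential lies below its chord over `[0, a]`. -/
theorem exp_le_affine {a c x : ℝ} (hx : 0 ≤ x) (hx1 : x ≤ 1) (hc : Real.exp a ≤ 1 + c) :
    Real.exp (a * x) ≤ 1 + c * x := by
  have h := convexOn_exp.2 (Set.mem_univ 0) (Set.mem_univ a) (sub_nonneg.2 hx1) hx (by ring)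
  simp only [smul_eq_mul, mul_zero, zero_add, Real.exp_zero, mul_one] at h
  rw [mul_comm a x]
  nlinarith

theorem exp_two_mul_le {x : ℝ} (hx : 0 ≤ x) (hx1 : x ≤ 1) :
    Real.exp (2 * x) ≤ 1 + 13 / 2 * x := by
  refine exp_le_affine hx hx1 ?_
  have : Real.exp 2 = Real.exp 1 * Real.exp 1 := by
    rw [← Real.exp_add]; norm_num
  rw [this]
  nlinarith [Real.exp_one_lt_d9, Real.exp_pos 1]

theorem exp_le_one_add_two_mul {x : ℝ} (hx : 0 ≤ x) (hx1 : x ≤ 1) :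
    Real.exp x ≤ 1 + 2 * x := by
  have := exp_le_affine (a := 1) (c := 2) hx hx1 (by linarith [Real.exp_one_lt_d9])
  rwa [one_mul] at this

/-- Rounding tags down to the bin end costs at most `e^{2τ} - 1 ≤ 6.5 τ` even for squares, and
fluctuations cost less than `τ` more, which fits into `8 τ`. -/
theorem close_of_concentrated {c m W : ℝ} (ht : 0 ≤ p.tau) (ht1 : p.tau ≤ 1) (hW : 0 ≤ W)
    (h1 : W ≤ m) (h2 : m ≤ Real.exp (2 * p.tau) * W)
    (h : |c - m| ≤ p.tau / 10 * (m + W)) : Close p c W := by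
  have he := exp_two_mul_le ht ht1
  have h3 : m ≤ (1 + 13 / 2 * p.tau) * W := h2.trans (by gcongr)
  obtain ⟨ha, hb⟩ := abs_le.1 h
  have hmW : m ≤ 15 / 2 * W := by nlinarith
  have htm : p.tau * m ≤ p.tau * (15 / 2 * W) := by gcongr
  have htW : 0 ≤ p.tau * W := by positivity
  have htm' : (1 - p.tau / 10) * W ≤ (1 - p.tau / 10) * m := by
    gcongr; linarith
  constructor <;> nlinarith

/-- The soundness converse: a passed test first gives the crude `m ≤ 11 W`, after which the
fluctuation is at most `1.2 τ W` on top of the test's own `8 τ W`. -/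
theorem abs_sub_le_of_close {c m W : ℝ} (ht : 0 ≤ p.tau) (ht1 : p.tau ≤ 1) (hW : 0 ≤ W)
    (h : |c - m| ≤ p.tau / 10 * (m + W)) (hc : Close p c W) :
    |m - W| ≤ 10 * p.tau * W := by
  obtain ⟨ha, hb⟩ := abs_le.1 h
  obtain ⟨h1, h2⟩ := hc
  have htW : 0 ≤ p.tau * W := by positivity
  have hmW : m ≤ 11 * W := by
    by_contra hcon
    rw [not_le] at hcon
    have : p.tau * m ≤ 1 * m := by
      gcongr; linarith
    nlinarith
  have htm : p.tau * m ≤ p.tau * (11 * W) := by gcongr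
  rw [abs_le]
  constructor <;> nlinarith

/-- For the honest prover, concentration of the counts implies that the tests pass. -/
theorem Regular.checks_of_concentrated (h : Regular p) (D : PMF (Fin p.N)) (S : p.Sample)
    (π : p.Tags) (hπ : ∀ i, π i = if p.pMin ≤ mass D (S i) then mass D (S i) else 0)
    (y : (p.Sample × p.Sample) × p.Noise)
    (hc : Concentrated p D S (fun j => bin p π j) (lightBin p π) y) :
    BinCheck p S π y.1.1 y.1.2 y.2.2.1 y.2.2.2.1 ∧ LightCheck p S π y.1.1 y.2.2.2.2 := by
  have ht := h.tau_pos
  have ht1 := h.tau_le_one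
  have hs := h.s_pos
  constructor
  · intro j hj
    obtain ⟨h1, h2⟩ := hc.1 j hj
    have hb := h.binLeft_pos j
    have hmem : ∀ i ∈ bin p π j, p.binLeft j ≤ mass D (S i) ∧
        mass D (S i) ≤ Real.exp p.tau * p.binLeft j := by
      intro i hi
      obtain ⟨h3, h4⟩ := (Finset.mem_filter.1 hi).2
      have hpi : π i = mass D (S i) := by
        rw [hπ i] at h3 ⊢
        split_ifs with hif
        · rfl
        · rw [if_neg hif] at h3; linarith
      rw [hpi, Regular.binLeft_succ] at h4
      rw [hpi] at h3
      exact ⟨h3, h4.le⟩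
    have hexp : Real.exp p.tau * Real.exp p.tau = Real.exp (2 * p.tau) := by
      rw [← Real.exp_add]; congr 1; ring
    have he1 : Real.exp p.tau ≤ Real.exp (2 * p.tau) := Real.exp_le_exp.2 (by linarith)
    set J := bin p π j
    have m1l : J.card * p.binLeft j ≤ moment₁ p D S J := by
      have := Finset.card_nsmul_le_sum J (fun k => mass D (S k)) _ fun i hi => (hmem i hi).1
      simpa [moment₁] using this
    have m1u : moment₁ p D S J ≤ J.card * (Real.exp p.tau * p.binLeft j) := by
      have := Finset.sum_le_card_nsmul J (fun k => mass D (S k)) _ fun i hi => (hmem i hi).2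
      simpa [moment₁] using this
    have m2l : J.card * p.binLeft j ^ 2 ≤ moment₂ p D S J := by
      have := Finset.card_nsmul_le_sum J (fun k => mass D (S k) ^ 2) (p.binLeft j ^ 2)
        fun i hi => pow_le_pow_left₀ hb.le (hmem i hi).1 2
      simpa [moment₂] using this
    have m2u : moment₂ p D S J ≤ J.card * (Real.exp p.tau * p.binLeft j) ^ 2 := by
      have := Finset.sum_le_card_nsmul J (fun k => mass D (S k) ^ 2)
        ((Real.exp p.tau * p.binLeft j) ^ 2)
        fun i hi => pow_le_pow_left₀ (mass_nonneg _ _) (hmem i hi).2 2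
      simpa [moment₂] using this
    refine ⟨close_of_concentrated ht.le ht1 (by positivity) ?_ ?_ h1,
      close_of_concentrated ht.le ht1 (by positivity) ?_ ?_ h2⟩
    · rw [mul_assoc]; gcongr
    · calc p.s * moment₁ p D S J ≤ p.s * (J.card * (Real.exp p.tau * p.binLeft j)) := by gcongr
        _ ≤ p.s * (J.card * (Real.exp (2 * p.tau) * p.binLeft j)) := by gcongr
        _ = _ := by ring
    · rw [mul_assoc]; gcongr
    · calc (p.s : ℝ) ^ 2 * moment₂ p D S J
          ≤ (p.s : ℝ) ^ 2 * (J.card * (Real.exp p.tau * p.binLeft j) ^ 2) := by gcongr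
        _ = _ := by rw [← hexp]; ring
  · have h1 := hc.2
    have hm : moment₁ p D S (lightBin p π) ≤ p.s * p.pMin := by
      have hle : ∀ i ∈ lightBin p π, mass D (S i) ≤ p.pMin := by
        intro i hi
        have h0 := (Finset.mem_filter.1 hi).2
        rw [hπ i] at h0
        by_contra hcon
        rw [not_le] at hcon
        rw [if_pos hcon.le] at h0
        linarith [h.pMin_pos]
      have h2 := Finset.sum_le_card_nsmul _ (fun k => mass D (S k)) _ hle
      have h3 : ((lightBin p π).card : ℝ) ≤ p.s := by
        exact_mod_cast (Finset.card_le_univ _).trans_eq (Fintype.card_fin _)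
      rw [nsmul_eq_mul] at h2
      exact h2.trans (mul_le_mul_of_nonneg_right h3 h.pMin_pos.le)
    have h4 : p.s * moment₁ p D S (lightBin p π) ≤ p.pMin * (p.s : ℝ) ^ 2 := by
      calc _ ≤ p.s * (p.s * p.pMin) := by gcongr
        _ = _ := by ring
    have h5 := (abs_le.1 h1).2
    have : 0 < p.pMin * (p.s : ℝ) ^ 2 := mul_pos h.pMin_pos (by positivity)
    unfold LightCheck
    linarith

/-- If the light test passes and its count is concentrated, the light mass is small. -/
theorem Regular.lightMass_le (h : Regular p) (D : PMF (Fin p.N)) (S : p.Sample)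
    (π : p.Tags) (hπ : FormatCheck p π) (y : (p.Sample × p.Sample) × p.Noise)
    (hc : Concentrated p D S (fun j => bin p π j) (lightBin p π) y)
    (hl : LightCheck p S π y.1.1 y.2.2.2.2) : lightMass p D S π ≤ 3 * (p.σ / p.N) := by
  have hs := h.s_pos
  have h1 := (abs_le.1 hc.2).1
  unfold LightCheck at hl
  have e : (Finset.univ.filter fun i => π i < p.σ / p.N) = lightBin p π := by
    ext i
    simp only [lightBin, Finset.mem_filter, Finset.mem_univ, true_and]
    have hpm := h.pMin_pos
    constructor
    · intro hi
      rcases hπ i with h0 | h0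
      · exact h0
      · exact absurd h0.1 (not_le.2 hi)
    · intro hi; rw [hi]; exact hpm
  -- With mean `m` and `Y = p_min s²`, the test gives `m - (m + Y)/4 ≤ 2 Y`, that is `m ≤ 3 Y`.
  have h2 : p.s * moment₁ p D S (lightBin p π) ≤ 3 * (p.pMin * (p.s : ℝ) ^ 2) := by linarith
  have h3 : moment₁ p D S (lightBin p π) ≤ 3 * p.pMin * p.s := by
    refine le_of_mul_le_mul_left ?_ hs
    linarith
  unfold lightMass
  rw [e]
  change 1 / p.s * moment₁ p D S (lightBin p π) ≤ 3 * p.pMin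
  rw [one_div, inv_mul_le_iff₀ hs]
  linarith

theorem Regular.pairwiseDisjoint_bin (h : Regular p) (π : p.Tags) (s : Set ℤ) :
    s.PairwiseDisjoint fun j => bin p π j := by
  have hlt : ∀ i j : ℤ, i < j → Disjoint (bin p π i) (bin p π j) := by
    intro i j hij
    refine Finset.disjoint_left.2 fun k hi hj => ?_
    have h1 := (Finset.mem_filter.1 hi).2.2
    have h2 := (Finset.mem_filter.1 hj).2.1
    have h3 : p.binLeft (i + 1) ≤ p.binLeft j := by
      have hN := h.N_pos'
      have ht := h.tau_pos
      unfold Params.binLeft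
      have : ((i + 1 : ℤ) : ℝ) ≤ j := by exact_mod_cast hij
      gcongr
    linarith
  intro i _ j _ hij
  rcases lt_or_gt_of_ne hij with hl | hl
  · exact hlt i j hl
  · exact (hlt j i hl).symm

theorem Regular.exists_mem_bin (h : Regular p) (π : p.Tags) (i : Fin p.s)
    (h1 : p.pMin ≤ π i) (h2 : π i ≤ p.pMax) : ∃ j ∈ p.bins, i ∈ bin p π j := by
  have hN := h.N_pos'
  have ht := h.tau_pos
  have hp : 0 < p.N * π i := mul_pos hN (h.pMin_pos.trans_le h1)
  set j := ⌊Real.log (p.N * π i) / p.tau⌋ with hj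
  have hl : p.binLeft j ≤ π i := by
    unfold Params.binLeft
    rw [div_le_iff₀ hN, mul_comm (π i), ← Real.le_log_iff_exp_le hp, ← le_div_iff₀ ht]
    exact Int.floor_le _
  have hr : π i < p.binLeft (j + 1) := by
    unfold Params.binLeft
    rw [lt_div_iff₀ hN, mul_comm (π i), ← Real.log_lt_iff_lt_exp hp, ← div_lt_iff₀ ht]
    push_cast
    exact Int.lt_floor_add_one _
  exact ⟨j, (p.mem_bins h.N_pos h.σ_pos h.pMax_pos j).2 ⟨hl.trans h2, h1.trans_lt hr⟩,
    Finset.mem_filter.2 ⟨Finset.mem_univ _, hl, hr⟩⟩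

/-- The summand of `heavyError`. -/
def relErr (π d : ℝ) : ℝ := 1 - min (π / d) (d / π)

theorem relErr_nonneg {π d : ℝ} (hπ : 0 < π) (hd : 0 ≤ d) : 0 ≤ relErr π d := by
  unfold relErr
  rcases hd.eq_or_lt with h0 | h0
  · subst h0; simp
  · rcases le_total π d with h | h
    · have := (div_le_one h0).2 h
      linarith [min_le_left (π / d) (d / π)]
    · have := (div_le_one hπ).2 h
      linarith [min_le_right (π / d) (d / π)]

theorem relErr_le_one {π d : ℝ} (hπ : 0 < π) (hd : 0 ≤ d) : relErr π d ≤ 1 := by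
  have : 0 ≤ min (π / d) (d / π) := le_min (by positivity) (by positivity)
  unfold relErr; linarith

/-- The relative error is `|d - π| / max π d`. At `d = 0` the convention `π / 0 = 0` gives `1`, as
it should. -/
theorem relErr_le {π d : ℝ} (hπ : 0 < π) (hd : 0 ≤ d) : relErr π d ≤ |d - π| / π := by
  unfold relErr
  rw [le_div_iff₀ hπ]
  rcases hd.eq_or_lt with h0 | h0
  · subst h0; simp [abs_of_pos hπ]
  rcases le_total π d with h | h
  · have h1 : π / d ≤ d / π := ((div_le_one h0).2 h).trans ((one_le_div hπ).2 h)
    rw [min_eq_left h1, abs_of_nonneg (sub_nonneg.2 h)]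
    have : (1 - π / d) * d = d - π := by field_simp
    have h2 : 0 ≤ 1 - π / d := sub_nonneg.2 ((div_le_one h0).2 h)
    nlinarith
  · have h1 : d / π ≤ π / d := ((div_le_one hπ).2 h).trans ((one_le_div h0).2 h)
    rw [min_eq_right h1, abs_of_nonpos (sub_nonpos.2 h)]
    have : (1 - d / π) * π = π - d := by field_simp
    linarith

/-- The error of a bin whose first two moments are as claimed. -/
theorem Regular.sum_relErr_bin_le (h : Regular p) (D : PMF (Fin p.N)) (S : p.Sample)
    (π : p.Tags) (j : ℤ)
    (h1 : |p.s * moment₁ p D S (bin p π j) - p.s * (bin p π j).card * p.binLeft j|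
      ≤ 10 * p.tau * (p.s * (bin p π j).card * p.binLeft j))
    (h2 : |(p.s : ℝ) ^ 2 * moment₂ p D S (bin p π j)
        - (p.s : ℝ) ^ 2 * (bin p π j).card * p.binLeft j ^ 2|
      ≤ 10 * p.tau * ((p.s : ℝ) ^ 2 * (bin p π j).card * p.binLeft j ^ 2)) :
    ∑ i ∈ bin p π j, relErr (π i) (mass D (S i)) ≤ 18 * p.σ * (bin p π j).card := by
  have hs := h.s_pos
  have hb := h.binLeft_pos j
  have hσ := h.σ_pos
  have hσ1 := h.σ_lt
  have ht := h.tau_pos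
  set b := p.binLeft j
  set J := bin p π j
  set n : ℝ := ((J.card : ℕ) : ℝ)
  have hn : 0 ≤ n := Nat.cast_nonneg _
  have hm1 : (1 - 10 * p.tau) * (n * b) ≤ moment₁ p D S J := by
    refine le_of_mul_le_mul_left ?_ hs
    have := (abs_le.1 h1).1
    linarith
  have hm2 : moment₂ p D S J ≤ (1 + 10 * p.tau) * (n * b ^ 2) := by
    refine le_of_mul_le_mul_left ?_ (pow_pos hs 2)
    have := (abs_le.1 h2).2
    linarith
  -- Expanding the square leaves `moment₂ - 2 b moment₁ + n b²`. The main terms cancel and the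
  -- errors add to `10 τ + 20 τ`; this is why both moments are tested.
  have hvar : ∑ i ∈ J, (mass D (S i) - b) ^ 2 ≤ 30 * p.tau * (n * b ^ 2) := by
    have e : ∑ i ∈ J, (mass D (S i) - b) ^ 2
        = moment₂ p D S J - 2 * b * moment₁ p D S J + n * b ^ 2 := by
      simp only [sub_sq, Finset.sum_add_distrib, Finset.sum_sub_distrib, moment₁, moment₂,
        Finset.mul_sum, Finset.sum_const, nsmul_eq_mul]
      congr 2
      exact Finset.sum_congr rfl fun i _ => by ring
    have : 2 * b * ((1 - 10 * p.tau) * (n * b)) ≤ 2 * b * moment₁ p D S J := by gcongr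
    rw [e]; linarith
  -- AM-GM in the form `a ≤ σ b / 2 + a² / (2 σ b)` with `a = |D(S_i) - b|`; the term `2 τ` pays for
  -- replacing `π_i` by `b`. Summing the squares then costs `15 τ / σ = 15 σ²` per element.
  have hpt : ∀ i ∈ J, relErr (π i) (mass D (S i))
      ≤ (p.σ / 2 + 2 * p.tau) + (mass D (S i) - b) ^ 2 * (1 / (2 * p.σ * b ^ 2)) := by
    intro i hi
    obtain ⟨h3, h4⟩ := (Finset.mem_filter.1 hi).2
    rw [Regular.binLeft_succ] at h4
    have hπ : 0 < π i := hb.trans_le h3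
    have h5 : π i - b ≤ 2 * p.tau * b := by
      have := exp_le_one_add_two_mul ht.le h.tau_le_one
      nlinarith
    have h6 : |mass D (S i) - π i| ≤ |mass D (S i) - b| + 2 * p.tau * b := by
      have := abs_sub_le (mass D (S i)) b (π i)
      rw [abs_sub_comm b (π i), abs_of_nonneg (sub_nonneg.2 h3)] at this
      linarith
    have h7 : |mass D (S i) - π i| / π i ≤ (|mass D (S i) - b| + 2 * p.tau * b) / b := by
      gcongr
    refine (relErr_le hπ (mass_nonneg _ _)).trans (h7.trans ?_)
    set a := |mass D (S i) - b|
    have ha : (mass D (S i) - b) ^ 2 = a ^ 2 := (sq_abs _).symm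
    rw [ha, div_le_iff₀ hb]
    have e : (p.σ / 2 + 2 * p.tau + a ^ 2 * (1 / (2 * p.σ * b ^ 2))) * b
        = (p.σ * b / 2 + a ^ 2 / (2 * (p.σ * b))) + 2 * p.tau * b := by
      field_simp
      ring
    rw [e]
    have hσb : 0 < p.σ * b := by positivity
    have : a ≤ p.σ * b / 2 + a ^ 2 / (2 * (p.σ * b)) := by
      rw [div_add_div _ _ (by norm_num) (by positivity), le_div_iff₀ (by positivity)]
      nlinarith [sq_nonneg (a - p.σ * b)]
    linarith
  refine (Finset.sum_le_sum hpt).trans ?_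
  rw [Finset.sum_add_distrib, ← Finset.sum_mul, Finset.sum_const, nsmul_eq_mul]
  have h8 : (∑ i ∈ J, (mass D (S i) - b) ^ 2) * (1 / (2 * p.σ * b ^ 2))
      ≤ 30 * p.tau * (n * b ^ 2) * (1 / (2 * p.σ * b ^ 2)) := by gcongr
  have h9 : 30 * p.tau * (n * b ^ 2) * (1 / (2 * p.σ * b ^ 2)) = 15 * p.σ ^ 2 * n := by
    unfold Params.tau; field_simp; ring
  have h10 : p.σ ^ 2 ≤ p.σ := by nlinarith
  have h11 : p.tau ≤ p.σ := by
    unfold Params.tau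
    calc p.σ ^ 3 = p.σ ^ 2 * p.σ := by ring
      _ ≤ p.σ * 1 := by gcongr
      _ = p.σ := mul_one _
  have h12 : 15 * p.σ ^ 2 * n ≤ 15 * p.σ * n := by gcongr
  have h13 : n * (p.σ / 2 + 2 * p.tau) ≤ n * (p.σ / 2 + 2 * p.σ) := by gcongr
  have : 0 ≤ p.σ * n := by positivity
  change n * (p.σ / 2 + 2 * p.tau) + _ ≤ _
  linarith

/-- If the bin tests pass and their counts are concentrated, the heavy error is small. -/
theorem Regular.heavyError_le (h : Regular p) (D : PMF (Fin p.N)) (S : p.Sample)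
    (π : p.Tags) (hπ : FormatCheck p π) (y : (p.Sample × p.Sample) × p.Noise)
    (hc : Concentrated p D S (fun j => bin p π j) (lightBin p π) y)
    (hb : BinCheck p S π y.1.1 y.1.2 y.2.2.1 y.2.2.2.1) : heavyError p D S π ≤ 20 * p.σ := by
  have hs := h.s_pos
  have hσ := h.σ_pos
  have ht := h.tau_pos
  have hB := h.one_le_B
  have hbm := h.bMin_pos
  have hpm := h.pMin_pos
  have hbin : ∀ j ∈ p.bins, ∑ i ∈ bin p π j, relErr (π i) (mass D (S i))
      ≤ 18 * p.σ * (bin p π j).card + p.bMin := by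
    intro j hj
    have hbl := h.binLeft_pos j
    by_cases hcard : p.bMin ≤ ((bin p π j).card : ℝ)
    · obtain ⟨c1, c2⟩ := hc.1 ⟨j, hj⟩ hcard
      obtain ⟨b1, b2⟩ := hb ⟨j, hj⟩ hcard
      have := h.sum_relErr_bin_le D S π j
        (abs_sub_le_of_close ht.le h.tau_le_one (by positivity) c1 b1)
        (abs_sub_le_of_close ht.le h.tau_le_one (by positivity) c2 b2)
      linarith
    · rw [not_le] at hcard
      have h1 : ∑ i ∈ bin p π j, relErr (π i) (mass D (S i)) ≤ (bin p π j).card • (1 : ℝ) := by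
        refine Finset.sum_le_card_nsmul _ _ _ fun i hi => relErr_le_one ?_ (mass_nonneg _ _)
        exact hbl.trans_le (Finset.mem_filter.1 hi).2.1
      rw [nsmul_eq_mul, mul_one] at h1
      have : 0 ≤ 18 * p.σ * (bin p π j).card := by positivity
      linarith
  set H := Finset.univ.filter fun i => p.σ / p.N ≤ π i
  have hsub : H ⊆ p.bins.biUnion fun j => bin p π j := by
    intro i hi
    have h1 : p.pMin ≤ π i := (Finset.mem_filter.1 hi).2
    have h2 : π i ≤ p.pMax := by
      rcases hπ i with h0 | h0
      · rw [h0]; exact h.pMax_pos.le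
      · exact h0.2
    obtain ⟨j, hj, hij⟩ := h.exists_mem_bin π i h1 h2
    exact Finset.mem_biUnion.2 ⟨j, hj, hij⟩
  have hdisj := h.pairwiseDisjoint_bin π (p.bins : Set ℤ)
  have hsum : ∑ i ∈ H, relErr (π i) (mass D (S i))
      ≤ ∑ j ∈ p.bins, ∑ i ∈ bin p π j, relErr (π i) (mass D (S i)) := by
    rw [← Finset.sum_biUnion hdisj]
    refine Finset.sum_le_sum_of_subset_of_nonneg hsub fun i hi _ => relErr_nonneg ?_
      (mass_nonneg _ _)
    obtain ⟨j, -, hij⟩ := Finset.mem_biUnion.1 hi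
    exact (h.binLeft_pos j).trans_le (Finset.mem_filter.1 hij).2.1
  have hcard : ∑ j ∈ p.bins, ((bin p π j).card : ℝ) ≤ p.s := by
    have : ∑ j ∈ p.bins, (bin p π j).card ≤ p.s := by
      rw [← Finset.card_biUnion hdisj]
      exact (Finset.card_le_univ _).trans_eq (Fintype.card_fin _)
    exact_mod_cast this
  -- The definition of `b_min` is tuned for this: untested bins can be entirely wrong and still
  -- contribute only `O(σ s)`.
  have hsmall : (p.bins.card : ℝ) * p.bMin ≤ 3 / 2 * p.σ * p.s := by
    calc (p.bins.card : ℝ) * p.bMin ≤ 3 * p.B * p.bMin := by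
          gcongr; exact h.card_bins_le
      _ = _ := by
          have : p.B ≠ 0 := by linarith
          unfold Params.bMin; field_simp
  have htot : ∑ i ∈ H, relErr (π i) (mass D (S i)) ≤ 20 * p.σ * p.s := by
    refine hsum.trans ((Finset.sum_le_sum hbin).trans ?_)
    rw [Finset.sum_add_distrib, ← Finset.mul_sum, Finset.sum_const, nsmul_eq_mul]
    have : 18 * p.σ * ∑ j ∈ p.bins, ((bin p π j).card : ℝ) ≤ 18 * p.σ * p.s := by gcongr
    have : 0 ≤ p.σ * p.s := by positivity
    linarith
  change 1 / p.s * ∑ i ∈ H, relErr (π i) (mass D (S i)) ≤ _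
  rw [one_div, inv_mul_le_iff₀ hs]
  linarith

/-- The output of the honest prover is accurate. -/
theorem Regular.honest_accurate (h : Regular p) (D : PMF (Fin p.N)) (S : p.Sample)
    (π : p.Tags) (hπ : ∀ i, π i = if p.pMin ≤ mass D (S i) then mass D (S i) else 0) :
    heavyError p D S π ≤ 0 ∧ lightMass p D S π ≤ p.σ / p.N := by
  have hs := h.s_pos
  have hpm := h.pMin_pos
  constructor
  · unfold heavyError
    refine mul_nonpos_of_nonneg_of_nonpos (by positivity) (Finset.sum_nonpos fun i hi => ?_)
    have h1 : p.pMin ≤ π i := (Finset.mem_filter.1 hi).2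
    have h2 : π i = mass D (S i) := by
      rw [hπ i] at h1 ⊢
      split_ifs with hif
      · rfl
      · rw [if_neg hif] at h1; linarith
    rw [← h2, div_self (by linarith)]
    simp
  · unfold lightMass
    rw [one_div, inv_mul_le_iff₀ hs]
    have hle : ∀ i ∈ Finset.univ.filter (fun i => π i < p.σ / p.N), mass D (S i) ≤ p.pMin := by
      intro i hi
      have h1 : π i < p.pMin := (Finset.mem_filter.1 hi).2
      by_contra hcon
      rw [not_le] at hcon
      rw [hπ i, if_pos hcon.le] at h1
      linarith
    refine (Finset.sum_le_card_nsmul _ _ _ hle).trans ?_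
    rw [nsmul_eq_mul]
    have h3 : ((Finset.univ.filter fun i => π i < p.σ / p.N).card : ℝ) ≤ p.s := by
      exact_mod_cast (Finset.card_le_univ _).trans_eq (Fintype.card_fin _)
    exact mul_le_mul_of_nonneg_right h3 hpm.le

end TaggedSample
end

noncomputable section
namespace TaggedSample

/-! ### The parameter range -/

theorem eventually_mul_log_pow_le (c : ℝ) (a : ℕ) {r : ℝ} (hr : 0 < r) :
    ∀ᶠ N : ℕ in atTop, c * Real.log N ^ a ≤ (N : ℝ) ^ r := by
  have h := (isLittleO_log_rpow_rpow_atTop (a : ℝ) hr).def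
    (show (0 : ℝ) < 1 / (|c| + 1) by positivity)
  filter_upwards [tendsto_natCast_atTop_atTop.eventually h, eventually_ge_atTop 1] with N hN hN1
  have hlog : 0 ≤ Real.log (N : ℝ) := Real.log_natCast_nonneg N
  rw [Real.rpow_natCast, Real.norm_of_nonneg (by positivity), Real.norm_of_nonneg (by positivity),
    one_div, ← div_eq_inv_mul, le_div_iff₀ (by positivity)] at hN
  have h1 : c ≤ |c| + 1 := by linarith [le_abs_self c]
  calc c * Real.log N ^ a ≤ (|c| + 1) * Real.log N ^ a := by gcongr
    _ ≤ _ := by linarith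

theorem eventually_le_rpow (c : ℝ) {r : ℝ} (hr : 0 < r) :
    ∀ᶠ N : ℕ in atTop, c ≤ (N : ℝ) ^ r :=
  ((tendsto_rpow_atTop hr).comp tendsto_natCast_atTop_atTop).eventually_ge_atTop c

variable {p : Params}

/-- The main inequality between the sample size and the other parameters. -/
theorem main_inequality {E ℓ L : ℝ} (hN : (0 : ℝ) < p.N) (hε : 0 < p.ε) (hεE : p.ε ≤ E)
    (hE : 1 ≤ E) (hσ : 0 < p.σ) (hL : L = Real.log (1 / p.δ)) (hL1 : 1 / 2 ≤ L) (hℓ : 1 ≤ ℓ)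
    (hlog : Real.log p.s ≤ ℓ) (hB0 : 0 ≤ p.B) (hB : p.B ≤ 2 * ℓ / p.σ ^ 3)
    (hs : ((p.N : ℝ) / p.ε) ^ 2 * ℓ ^ 6 * (L / p.σ) ^ 15 ≤ (p.s : ℝ) ^ 3)
    (hbig : 2 * 10 ^ 12 * E ^ 2 ≤ ℓ ^ 3) :
    864 * p.B ^ 2 * (6192 + (84 + 9600 * Real.log (1 / p.δ) + 60 * p.Delta) / p.ε)
      * (p.N : ℝ) ^ 2 ≤ (p.s : ℝ) ^ 3 * p.σ ^ 9 := by
  set G := 6192 + (84 + 9600 * Real.log (1 / p.δ) + 60 * p.Delta) / p.ε with hG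
  -- Multiplying by `ε²` clears the factor `1/ε²`, which comes from the part of `Δ` of order
  -- `log(1/δ)/ε`.
  have hGε : G * p.ε ^ 2 ≤ 22812 * E ^ 2 * L * ℓ := by
    have e : G * p.ε ^ 2
        = 6192 * p.ε ^ 2 + p.ε * (84 + 9600 * L + 180 * Real.log p.s) + 300 * L := by
      rw [hG, Params.Delta, ← hL]; field_simp; ring
    have h1 : p.ε * (84 + 9600 * L + 180 * Real.log p.s) ≤ E * (84 + 9600 * L + 180 * ℓ) := by
      have : 0 ≤ Real.log (p.s : ℝ) := Real.log_natCast_nonneg _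
      gcongr
    have h2 : p.ε ^ 2 ≤ E ^ 2 := by gcongr
    have hLℓ : 1 ≤ 2 * (L * ℓ) := by nlinarith
    have h3 : E ^ 2 * 1 ≤ E ^ 2 * (2 * (L * ℓ)) := by gcongr
    have hEE : E ≤ E ^ 2 := by nlinarith
    have h4 : E * 84 ≤ E ^ 2 * (2 * (L * ℓ)) * 84 := by nlinarith
    have h5 : E * L ≤ E ^ 2 * (L * ℓ) := by
      calc E * L ≤ E ^ 2 * L := by gcongr
        _ ≤ E ^ 2 * (L * ℓ) := by
          gcongr; nlinarith
    have h6 : E * ℓ ≤ E ^ 2 * (2 * (L * ℓ)) := by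
      calc E * ℓ ≤ E ^ 2 * ℓ := by gcongr
        _ ≤ E ^ 2 * (2 * (L * ℓ)) := by
          gcongr; nlinarith
    have h7 : L ≤ E ^ 2 * (L * ℓ) := by
      have : L ≤ E * L := by nlinarith
      linarith
    rw [e]
    linarith
  -- `L` can be less than `1` when `δ` is near `1/2`, so raising its power costs `2¹⁴`.
  have hL14 : 1 ≤ 16384 * L ^ 14 := by
    have : (1 / 2 : ℝ) ^ 14 ≤ L ^ 14 := by gcongr
    norm_num at this
    linarith
  -- Of the six logarithms in the bound on `s³`, two pay for `B²`, one for `G`, and the other three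
  -- absorb the constants and `E²`.
  have hkey : 3456 * (G * p.ε ^ 2) ≤ ℓ ^ 4 * L ^ 15 := by
    have hLℓ : 0 ≤ L * ℓ := by positivity
    calc 3456 * (G * p.ε ^ 2) ≤ 3456 * (22812 * E ^ 2 * L * ℓ) := by gcongr
      _ = 78838272 * E ^ 2 * (L * ℓ) * 1 := by ring
      _ ≤ 78838272 * E ^ 2 * (L * ℓ) * (16384 * L ^ 14) := by gcongr
      _ = 1291686248448 * E ^ 2 * (L * ℓ * L ^ 14) := by ring
      _ ≤ 2 * 10 ^ 12 * E ^ 2 * (L * ℓ * L ^ 14) := by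
          gcongr; norm_num
      _ ≤ ℓ ^ 3 * (L * ℓ * L ^ 14) := by gcongr
      _ = ℓ ^ 4 * L ^ 15 := by ring
  have hG0 : 0 ≤ G := by
    have h1 : 0 ≤ Real.log (p.s : ℝ) := Real.log_natCast_nonneg _
    have h2 : 0 ≤ p.Delta := by
      unfold Params.Delta
      rw [← hL]; positivity
    rw [hG, ← hL]
    positivity
  calc 864 * p.B ^ 2 * G * (p.N : ℝ) ^ 2
      ≤ 864 * (2 * ℓ / p.σ ^ 3) ^ 2 * G * (p.N : ℝ) ^ 2 := by gcongr
    _ = 3456 * (G * p.ε ^ 2) * (ℓ ^ 2 * ((p.N : ℝ) / p.ε) ^ 2 / p.σ ^ 6) := by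
        field_simp; ring
    _ ≤ ℓ ^ 4 * L ^ 15 * (ℓ ^ 2 * ((p.N : ℝ) / p.ε) ^ 2 / p.σ ^ 6) := by gcongr
    _ = ((p.N : ℝ) / p.ε) ^ 2 * ℓ ^ 6 * (L / p.σ) ^ 15 * p.σ ^ 9 := by
        field_simp
    _ ≤ _ := by gcongr

/-- An upper bound on the sample size. -/
theorem sampleScale_le {E L : ℝ} {N : ℕ} {ε δ σ c η : ℝ} (a k : ℕ) (hN : 1 ≤ N) (hε : 0 < ε)
    (hεE : ε ≤ E) (hE : 1 ≤ E) (hσ : 0 < σ) (hσ1 : σ < 1) (hL : L = Real.log (1 / δ))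
    (hL1 : 1 / 2 ≤ L) (hη : η * (k + 1) = 1 / 100) (hQ : L / (ε * σ) ≤ (N : ℝ) ^ η) (hc : 0 ≤ c)
    (hlog : c * 2 * E ^ k * Real.log N ^ a ≤ (N : ℝ) ^ (1 / 100 : ℝ)) :
    c * sampleScale a k N ε δ σ ≤ (N : ℝ) ^ (7 / 10 : ℝ) := by
  have hN0 : (0 : ℝ) < N := by exact_mod_cast hN
  have hN1 : (1 : ℝ) ≤ N := by exact_mod_cast hN
  have hη0 : 0 < η := by
    by_contra hcon
    have : η * (k + 1) ≤ 0 := mul_nonpos_of_nonpos_of_nonneg (not_lt.1 hcon) (by positivity)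
    linarith
  have hL0 : 0 < L := by linarith
  -- Since `L ≥ 1/2` and `σ < 1`, the hypothesis on `L / (ε σ)` also bounds `1/ε`.
  have hinv : 1 / ε ≤ 2 * (N : ℝ) ^ η := by
    have : 1 / ε ≤ 2 * (L / (ε * σ)) := by
      rw [div_le_iff₀ hε, mul_assoc, div_mul_eq_mul_div, mul_div_assoc',
        le_div_iff₀ (by positivity)]
      nlinarith
    linarith
  have h1 : ((N : ℝ) / ε) ^ (2 / 3 : ℝ) ≤ 2 * (N : ℝ) ^ (2 / 3 + η) := by
    calc ((N : ℝ) / ε) ^ (2 / 3 : ℝ) ≤ (2 * (N : ℝ) ^ (1 + η)) ^ (2 / 3 : ℝ) := by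
          refine Real.rpow_le_rpow (by positivity) ?_ (by norm_num)
          rw [Real.rpow_add hN0, Real.rpow_one, div_eq_mul_one_div]
          calc (N : ℝ) * (1 / ε) ≤ N * (2 * (N : ℝ) ^ η) := by gcongr
            _ = _ := by ring
      _ = 2 ^ (2 / 3 : ℝ) * (N : ℝ) ^ ((1 + η) * (2 / 3)) := by
          rw [Real.mul_rpow (by norm_num) (by positivity), ← Real.rpow_mul hN0.le]
      _ ≤ 2 ^ (1 : ℝ) * (N : ℝ) ^ (2 / 3 + η) := by
          gcongr
          · norm_num
          · norm_num
          · linarith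
      _ = _ := by rw [Real.rpow_one]
  have h2 : (L / σ) ^ k ≤ E ^ k * (N : ℝ) ^ (η * k) := by
    have : L / σ ≤ E * (N : ℝ) ^ η := by
      calc L / σ = ε * (L / (ε * σ)) := by field_simp
        _ ≤ E * (N : ℝ) ^ η := by gcongr
    calc (L / σ) ^ k ≤ (E * (N : ℝ) ^ η) ^ k := by gcongr
      _ = _ := by rw [mul_pow, ← Real.rpow_natCast ((N : ℝ) ^ η), ← Real.rpow_mul hN0.le]
  have hlog0 : 0 ≤ Real.log (N : ℝ) := Real.log_natCast_nonneg _
  unfold sampleScale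
  rw [← hL]
  calc c * (((N : ℝ) / ε) ^ (2 / 3 : ℝ) * Real.log N ^ a * (L / σ) ^ k)
      ≤ c * (2 * (N : ℝ) ^ (2 / 3 + η) * Real.log N ^ a * (E ^ k * (N : ℝ) ^ (η * k))) := by
        gcongr
    _ = c * 2 * E ^ k * Real.log N ^ a * ((N : ℝ) ^ (2 / 3 + η) * (N : ℝ) ^ (η * k)) := by ring
    _ = c * 2 * E ^ k * Real.log N ^ a * (N : ℝ) ^ (2 / 3 + 1 / 100 : ℝ) := by
        rw [← Real.rpow_add hN0, ← hη]; congr 2; ring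
    _ ≤ (N : ℝ) ^ (1 / 100 : ℝ) * (N : ℝ) ^ (2 / 3 + 1 / 100 : ℝ) := by gcongr
    _ = (N : ℝ) ^ (1 / 100 + (2 / 3 + 1 / 100) : ℝ) := by rw [← Real.rpow_add hN0]
    _ ≤ (N : ℝ) ^ (7 / 10 : ℝ) := Real.rpow_le_rpow_of_exponent_le hN1 (by norm_num)

/-- For large `N` the hypotheses on the parameters imply `Regular`. -/
theorem eventually_regular (ε₀ K : ℝ) (a k : ℕ) (φ : ℕ → ℝ) (hφ : Tendsto φ atTop (𝓝 0)) :
    ∀ᶠ N : ℕ in atTop, ∀ p : Params, p.N = N → 0 < p.ε → p.ε ≤ ε₀ → 0 < p.δ → p.δ ≤ 1 / 2 →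
      0 < p.σ → p.σ < 1 → Real.log (1 / p.δ) / (p.ε * p.σ) ≤ (p.N : ℝ) ^ φ p.N →
      sampleScale 2 5 p.N p.ε p.δ p.σ ≤ p.s →
      (p.s : ℝ) ≤ K * sampleScale a k p.N p.ε p.δ p.σ → Regular p := by
  set E := max ε₀ 1
  have hE : 1 ≤ E := le_max_right _ _
  -- Small enough that `N/ε` and the `k`-th power of `L/σ` together exceed `N^{2/3}` by at most
  -- `N^{1/100}` apart from constants, leaving `s ≤ N^{7/10}`.
  set η : ℝ := 1 / (100 * (k + 1)) with hηdef
  have hη0 : 0 < η := by positivity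
  have hη : η * (k + 1) = 1 / 100 := by rw [hηdef]; field_simp
  have hlogtop : Tendsto (fun N : ℕ => Real.log (N : ℝ)) atTop atTop :=
    Real.tendsto_log_atTop.comp tendsto_natCast_atTop_atTop
  filter_upwards [hφ.eventually (gt_mem_nhds hη0), eventually_ge_atTop 1,
    hlogtop.eventually_ge_atTop 1, hlogtop.eventually_ge_atTop (2 * 10 ^ 12 * E ^ 2),
    eventually_mul_log_pow_le (|K| * 2 * E ^ k) a (show (0 : ℝ) < 1 / 100 by norm_num),
    eventually_le_rpow 100 (show (0 : ℝ) < 1 / 5 by norm_num),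
    eventually_le_rpow (6 * E) (show (0 : ℝ) < 3 / 10 by norm_num),
    eventually_le_rpow (6400 * E ^ (2 / 3 : ℝ)) (show (0 : ℝ) < 2 / 3 by norm_num)]
    with N hφN hN1 hlog1 hlogbig hK h100 h6E h6400 p hpN hε hεε₀ hδ hδ1 hσ hσ1 hQ hsl hsu
  subst hpN
  have hN0 : (0 : ℝ) < p.N := by exact_mod_cast hN1
  have hN1' : (1 : ℝ) ≤ p.N := by exact_mod_cast hN1
  have hεE : p.ε ≤ E := hεε₀.trans (le_max_left _ _)
  have hL1 : 1 / 2 ≤ Real.log (1 / p.δ) := by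
    have h1 : (2 : ℝ) ≤ 1 / p.δ := by
      rw [le_div_iff₀ hδ]; linarith
    have := Real.log_le_log (by norm_num) h1
    linarith [Real.log_two_gt_d9]
  set L := Real.log (1 / p.δ) with hL
  set ℓ := Real.log (p.N : ℝ) with hℓ
  have hQη : L / (p.ε * p.σ) ≤ (p.N : ℝ) ^ η :=
    hQ.trans (Real.rpow_le_rpow_of_exponent_le hN1' hφN.le)
  have hs200 : 200 ≤ (p.s : ℝ) := by
    refine le_trans ?_ hsl
    unfold sampleScale
    have h1 : 6400 ≤ ((p.N : ℝ) / p.ε) ^ (2 / 3 : ℝ) := by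
      calc (6400 : ℝ) ≤ (p.N : ℝ) ^ (2 / 3 : ℝ) / E ^ (2 / 3 : ℝ) := by
            rwa [le_div_iff₀ (by positivity)]
        _ = ((p.N : ℝ) / E) ^ (2 / 3 : ℝ) := by rw [Real.div_rpow hN0.le (by positivity)]
        _ ≤ _ := by gcongr
    have h2 : (1 / 2 : ℝ) ≤ L / p.σ := by
      rw [le_div_iff₀ hσ]; nlinarith
    calc (200 : ℝ) = 6400 * 1 ^ 2 * (1 / 2) ^ 5 := by norm_num
      _ ≤ _ := by gcongr
  have hs0 : (0 : ℝ) < p.s := by linarith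
  have hs7 : (p.s : ℝ) ≤ (p.N : ℝ) ^ (7 / 10 : ℝ) := by
    have h1 := sampleScale_le (c := |K|) a k hN1 hε hεE hE hσ hσ1 hL hL1 hη hQη (abs_nonneg K) hK
    have h2 : 0 ≤ sampleScale a k p.N p.ε p.δ p.σ := by
      unfold sampleScale; positivity
    exact hsu.trans ((mul_le_mul_of_nonneg_right (le_abs_self K) h2).trans h1)
  have hsN : (p.s : ℝ) ≤ p.N :=
    hs7.trans ((Real.rpow_le_rpow_of_exponent_le hN1' (by norm_num)).trans_eq (Real.rpow_one _))
  have hτ : 0 < p.tau := pow_pos hσ 3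
  have hτ1 : p.tau ≤ 1 := pow_le_one₀ hσ.le hσ1.le
  have hratio : p.pMax / p.pMin = L / (p.ε * p.σ) * (p.N / p.s) := by
    unfold Params.pMax Params.pMin; field_simp; rfl
  have hratio0 : 0 < p.pMax / p.pMin := by rw [hratio]; positivity
  -- The ratio is at least `N^{3/10} / (2 E)`, which eventually exceeds `e`; as `τ ≤ 1`, this yields
  -- `B ≥ 1`.
  have hlower : 1 ≤ Real.log (p.pMax / p.pMin) := by
    rw [Real.le_log_iff_exp_le hratio0]
    have h1 : (p.N : ℝ) ^ (3 / 10 : ℝ) ≤ p.N / p.s := by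
      rw [le_div_iff₀ hs0]
      calc (p.N : ℝ) ^ (3 / 10 : ℝ) * p.s
          ≤ (p.N : ℝ) ^ (3 / 10 : ℝ) * (p.N : ℝ) ^ (7 / 10 : ℝ) := by gcongr
        _ = p.N := by rw [← Real.rpow_add hN0]; norm_num
    have h2 : 1 / (2 * E) ≤ L / (p.ε * p.σ) := by
      rw [div_le_div_iff₀ (by positivity) (by positivity)]
      have : p.ε * p.σ ≤ E * 1 := by gcongr
      nlinarith
    rw [hratio]
    calc Real.exp 1 ≤ 3 := by linarith [Real.exp_one_lt_d9]
      _ = 1 / (2 * E) * (6 * E) := by field_simp; norm_num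
      _ ≤ L / (p.ε * p.σ) * (p.N / p.s) := by
          gcongr
          exact h6E.trans h1
  have hupper : Real.log (p.pMax / p.pMin) ≤ 2 * ℓ := by
    have h1 : (p.N : ℝ) ^ η ≤ p.N := by
      have : η ≤ 1 := by
        rw [hηdef, div_le_one (by positivity)]
        have : (0 : ℝ) ≤ k := Nat.cast_nonneg k
        linarith
      exact (Real.rpow_le_rpow_of_exponent_le hN1' this).trans_eq (Real.rpow_one _)
    have h2 : p.pMax / p.pMin ≤ (p.N : ℝ) * p.N := by
      rw [hratio]
      have : (p.N : ℝ) / p.s ≤ p.N := div_le_self hN0.le (by linarith)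
      gcongr
      exact hQη.trans h1
    have h3 := Real.log_le_log hratio0 h2
    rw [Real.log_mul hN0.ne' hN0.ne'] at h3
    linarith
  have hB1 : 1 ≤ p.B := by
    unfold Params.B
    rw [le_div_iff₀ hτ]; linarith
  refine ⟨hN1, hε, hδ, hδ1, hσ, hσ1, hs200, ?_, hB1, ?_⟩
  · have h4 : (p.s : ℝ) ^ 4 ≤ (p.N : ℝ) ^ (14 / 5 : ℝ) := by
      calc (p.s : ℝ) ^ 4 ≤ ((p.N : ℝ) ^ (7 / 10 : ℝ)) ^ 4 := by gcongr
        _ = _ := by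
          rw [← Real.rpow_natCast, ← Real.rpow_mul hN0.le]; norm_num
    calc 100 * (p.s : ℝ) ^ 4 ≤ (p.N : ℝ) ^ (1 / 5 : ℝ) * (p.N : ℝ) ^ (14 / 5 : ℝ) := by gcongr
      _ = (p.N : ℝ) ^ (3 : ℕ) := by
          rw [← Real.rpow_add hN0, ← Real.rpow_natCast]; norm_num
  · refine main_inequality hN0 hε hεE hE hσ hL hL1 hlog1 (Real.log_le_log hs0 hsN) (by linarith)
      ?_ ?_ ?_
    · unfold Params.B Params.tau
      gcongr
    · have h1 : (((p.N : ℝ) / p.ε) ^ (2 / 3 : ℝ)) ^ 3 = ((p.N : ℝ) / p.ε) ^ 2 := by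
        rw [← Real.rpow_natCast, ← Real.rpow_mul (by positivity), ← Real.rpow_natCast]
        norm_num
      calc _ = (sampleScale 2 5 p.N p.ε p.δ p.σ) ^ 3 := by
            unfold sampleScale
            rw [mul_pow, mul_pow, h1, ← hL, ← hℓ]; ring
        _ ≤ _ := by
            have : 0 ≤ sampleScale 2 5 p.N p.ε p.δ p.σ := by
              unfold sampleScale; positivity
            gcongr
    · calc _ ≤ ℓ := hlogbig
        _ ≤ ℓ ^ 3 := le_self_pow₀ hlog1 (by norm_num)

end TaggedSample
end

noncomputable section
namespace TaggedSample

variable {p : Params}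

/-! ### The full execution -/

theorem measurableSet_filter_eq {X : Type*} [MeasurableSpace X] {n : ℕ} {P : Fin n → X → Prop}
    [∀ x, DecidablePred fun i => P i x] (hP : ∀ i, MeasurableSet {x | P i x})
    (J : Finset (Fin n)) : MeasurableSet {x | (Finset.univ.filter fun i => P i x) = J} := by
  have e : {x | (Finset.univ.filter fun i => P i x) = J}
      = ⋂ i, {x | P i x ↔ i ∈ J} := by
    ext x
    simp [Finset.ext_iff]
  rw [e]
  refine MeasurableSet.iInter fun i => ?_
  by_cases hi : i ∈ J
  · simpa [hi] using hP i
  · simp only [hi, iff_false]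
    exact (hP i).compl

/-- The finite information about the interaction on which the verifier's counts depend. -/
def interactionData (z : p.Sample × p.Tags) :
    p.Sample × (p.bins → Finset (Fin p.s)) × Finset (Fin p.s) :=
  (z.1, fun j => bin p z.2 j, lightBin p z.2)

theorem measurableSet_interactionData_fiber
    (e : p.Sample × (p.bins → Finset (Fin p.s)) × Finset (Fin p.s)) :
    MeasurableSet (interactionData (p := p) ⁻¹' {e}) := by
  have h : interactionData (p := p) ⁻¹' {e} = (Prod.fst ⁻¹' {e.1} ∩
      ⋂ j : p.bins, {z | bin p z.2 j = e.2.1 j}) ∩ {z | lightBin p z.2 = e.2.2} := by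
    ext z
    simp [interactionData, Prod.ext_iff, funext_iff, and_assoc]
  have hev : ∀ i, Measurable fun z : p.Sample × p.Tags => z.2 i := fun i =>
    (measurable_pi_apply i).comp measurable_snd
  rw [h]
  refine ((measurable_fst .of_discrete).inter (MeasurableSet.iInter fun j => ?_)).inter ?_
  · exact measurableSet_filter_eq
      (P := fun i (z : p.Sample × p.Tags) => p.binLeft j ≤ z.2 i ∧ z.2 i < p.binLeft (j + 1))
      (fun i => (measurableSet_le measurable_const (hev i)).inter
        (measurableSet_lt (hev i) measurable_const)) _
  · exact measurableSet_filter_eq (P := fun i (z : p.Sample × p.Tags) => z.2 i = 0)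
      (fun i => measurableSet_eq_fun (hev i) measurable_const) _

namespace Regular

/-- For any prover, the probability that the seed is fine but some noisy count is far from its
mean or the propose-test-release test fails. -/
theorem runLaw_bad_le (h : Regular p) (D : PMF (Fin p.N)) (hD : ∀ x, mass D x ≤ p.pMax)
    (P : Prover p) [IsMarkovKernel P] :
    runLaw p D P {ω | SeedCheck p ω.1.1 ∧
      (¬ Concentrated p D ω.1.1 (fun j => bin p ω.1.2 j) (lightBin p ω.1.2) ω.2 ∨
        ¬ PTRCheck p ω.1.1 ω.2.1.1 ω.2.1.2 ω.2.2.1)} ≤ ENNReal.ofReal (1 / 5) := by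
  classical
  have := h.isProbabilityMeasure_seedLaw
  have := h.isProbabilityMeasure_testLaw D
  -- The bad event sees real tags only through their bins. It suffices to bound it for each fixed
  -- value of this finite data, where the remaining randomness is that of `testLaw`.
  have key := prod_setOf_mem_le (seedLaw p ⊗ₘ P) (testLaw p D) interactionData
    measurableSet_interactionData_fiber
    (fun e => {y | SeedCheck p e.1 ∧ (¬ Concentrated p D e.1 e.2.1 e.2.2 y ∨
      ¬ PTRCheck p e.1 y.1.1 y.1.2 y.2.1)}) (ENNReal.ofReal (1 / 5)) ?_
  · exact key
  · intro e
    by_cases hS : SeedCheck p e.1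
    · have hsub : {y | SeedCheck p e.1 ∧ (¬ Concentrated p D e.1 e.2.1 e.2.2 y ∨
          ¬ PTRCheck p e.1 y.1.1 y.1.2 y.2.1)} ⊆
          {y | ¬ Concentrated p D e.1 e.2.1 e.2.2 y} ∪
          {y | ¬ PTRCheck p e.1 y.1.1 y.1.2 y.2.1} := fun y hy => hy.2
      refine (measure_mono hsub).trans ((measure_union_le _ _).trans ((add_le_add
        (h.not_concentrated_le D hD hS _ _) (h.not_ptrCheck_le D hD _)).trans ?_))
      rw [← ENNReal.ofReal_add (by norm_num) (by norm_num)]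
      exact ENNReal.ofReal_le_ofReal (by norm_num)
    · simp [hS]

theorem isProbabilityMeasure_runLaw (h : Regular p) (D : PMF (Fin p.N)) (P : Prover p)
    [IsMarkovKernel P] : IsProbabilityMeasure (runLaw p D P) := by
  have := h.isProbabilityMeasure_seedLaw
  have : IsProbabilityMeasure (((sampleLaw p D).prod (sampleLaw p D)).prod (noiseLaw p)) :=
    h.isProbabilityMeasure_testLaw D
  unfold runLaw; infer_instance

theorem three_quarters_le (h : Regular p) (D : PMF (Fin p.N)) (P : Prover p) [IsMarkovKernel P]
    {A : Set (Run p)} (hA : runLaw p D P Aᶜ ≤ ENNReal.ofReal (1 / 4)) :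
    3 / 4 ≤ runLaw p D P A := by
  have := h.isProbabilityMeasure_runLaw D P
  refine one_sub_le_of_compl_le _ A _ _ hA ?_ ENNReal.ofReal_ne_top
  have : (3 / 4 : ENNReal) = ENNReal.ofReal (3 / 4) := by
    rw [ENNReal.ofReal_div_of_pos (by norm_num)]; norm_num
  rw [this, ← ENNReal.ofReal_add (by norm_num) (by norm_num)]
  norm_num

/-- An accepting run has passed the seed check, so a failure must lie in the bad event of
`runLaw_bad_le`; a bad seed only leads to rejection and costs nothing here. -/
theorem soundness (h : Regular p) (D : PMF (Fin p.N)) (hD : ∀ x, mass D x ≤ p.pMax)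
    (P : Prover p) [IsMarkovKernel P] :
    3 / 4 ≤ runLaw p D P {ω | Accepts p ω → heavyError p D ω.1.1 ω.1.2 ≤ 20 * p.σ ∧
      lightMass p D ω.1.1 ω.1.2 ≤ 20 * (p.σ / p.N)} := by
  refine h.three_quarters_le D P ((measure_mono ?_).trans ((h.runLaw_bad_le D hD P).trans
    (ENNReal.ofReal_le_ofReal (by norm_num))))
  intro ω hω
  simp only [Set.mem_compl_iff, Set.mem_ofPred_eq] at hω ⊢
  by_contra hcon
  apply hω
  rintro ⟨hS, hF, -, hB, hL⟩
  have hc : Concentrated p D ω.1.1 (fun j => bin p ω.1.2 j) (lightBin p ω.1.2) ω.2 := by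
    by_contra hnc
    exact hcon ⟨hS, Or.inl hnc⟩
  refine ⟨h.heavyError_le D _ _ hF _ hc hB, (h.lightMass_le D _ _ hF _ hc hL).trans ?_⟩
  have : 0 < p.σ / p.N := h.pMin_pos
  linarith

theorem completeness (h : Regular p) (D : PMF (Fin p.N)) (hD : ∀ x, mass D x ≤ p.pMax) :
    3 / 4 ≤ runLaw p D (honestProver p D) {ω | Accepts p ω ∧
      heavyError p D ω.1.1 ω.1.2 ≤ 20 * p.σ ^ 3 ∧
      lightMass p D ω.1.1 ω.1.2 ≤ 20 * (p.σ / p.N)} := by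
  have : IsMarkovKernel (honestProver p D) := by unfold honestProver; infer_instance
  have := h.isProbabilityMeasure_seedLaw
  have := h.isProbabilityMeasure_testLaw D
  set tags : p.Sample → p.Tags :=
    fun S i => if p.pMin ≤ mass D (S i) then mass D (S i) else 0
  have hseed : runLaw p D (honestProver p D) {ω | ¬ SeedCheck p ω.1.1}
      ≤ ENNReal.ofReal (1 / 100) := by
    have hmp : MeasurePreserving (fun ω : Run p => ω.1) (runLaw p D (honestProver p D))
        (seedLaw p ⊗ₘ honestProver p D) :=
      measurePreserving_fst (ν := testLaw p D)
    have hmp2 : MeasurePreserving (fun z => z.1) (seedLaw p ⊗ₘ honestProver p D) (seedLaw p) :=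
      ⟨measurable_fst, Measure.fst_compProd _ _⟩
    exact (hmp2.comp hmp).measure_setOf_le (P := fun S => ¬ SeedCheck p S) .of_discrete
      h.not_seedCheck_le
  -- The execution law does not identify the tags pointwise with the honest ones, only up to a null
  -- set.
  have hdet : runLaw p D (honestProver p D) {ω | ω.1.2 ≠ tags ω.1.1} ≤ 0 := by
    have hmp : MeasurePreserving (fun ω : Run p => ω.1) (runLaw p D (honestProver p D))
        (seedLaw p ⊗ₘ honestProver p D) :=
      measurePreserving_fst (ν := testLaw p D)
    have hm : MeasurableSet {z : p.Sample × p.Tags | z.2 ≠ tags z.1} :=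
      (measurableSet_eq_fun measurable_snd
        ((Measurable.of_discrete (f := tags)).comp measurable_fst)).compl
    refine hmp.measure_setOf_le (P := fun z => z.2 ≠ tags z.1) hm (le_of_eq ?_)
    rw [honestProver, Measure.compProd_deterministic, Measure.map_apply .of_discrete hm]
    simp [tags]
  refine h.three_quarters_le D _ ((measure_mono ?_).trans ((measure_union_le _ _).trans
    ((add_le_add (measure_union_le _ _) le_rfl).trans ((add_le_add (add_le_add
      (h.runLaw_bad_le D hD (honestProver p D)) hseed) hdet).trans ?_))))
  · intro ω hω
    simp only [Set.mem_compl_iff, Set.mem_ofPred_eq, Set.mem_union] at hω ⊢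
    by_contra hcon
    apply hω
    obtain ⟨⟨c1, c2⟩, c3⟩ : ((¬ (SeedCheck p ω.1.1 ∧ _)) ∧ ¬ ¬ SeedCheck p ω.1.1) ∧
      ¬ (ω.1.2 ≠ tags ω.1.1) := by
      simpa only [not_or] using hcon
    rw [not_not] at c2 c3
    have hπ : ∀ i, ω.1.2 i = if p.pMin ≤ mass D (ω.1.1 i) then mass D (ω.1.1 i) else 0 :=
      fun i => by rw [c3]
    have hc : Concentrated p D ω.1.1 (fun j => bin p ω.1.2 j) (lightBin p ω.1.2) ω.2 := by
      by_contra hnc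
      exact c1 ⟨c2, Or.inl hnc⟩
    have hptr : PTRCheck p ω.1.1 ω.2.1.1 ω.2.1.2 ω.2.2.1 := by
      by_contra hnc
      exact c1 ⟨c2, Or.inr hnc⟩
    obtain ⟨hB, hL⟩ := h.checks_of_concentrated D _ _ hπ _ hc
    obtain ⟨a1, a2⟩ := h.honest_accurate D _ _ hπ
    have hF : FormatCheck p ω.1.2 := by
      intro i
      rw [hπ i]
      split_ifs with hif
      · exact Or.inr ⟨hif, hD _⟩
      · exact Or.inl rfl
    have hσ : 0 < p.σ / p.N := h.pMin_pos
    have hσ3 : 0 < p.σ ^ 3 := pow_pos h.σ_pos 3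
    exact ⟨⟨c2, hF, hptr, hB, hL⟩, by linarith, by linarith⟩
  · rw [add_zero, ← ENNReal.ofReal_add (by norm_num) (by norm_num)]
    exact ENNReal.ofReal_le_ofReal (by norm_num)

end Regular

end TaggedSample
end

/-! ### Choice of the absolute constants -/

theorem mainTheorem5 :
    ∃ (C : ℝ) (a₀ k₀ : ℕ), 0 < C ∧
      ∀ (ε₀ K : ℝ) (a k : ℕ) (φ : ℕ → ℝ), Tendsto φ atTop (𝓝 0) →
        ∃ N₀ : ℕ, ∀ p : TaggedSample.Params, N₀ ≤ p.N →
          0 < p.ε → p.ε ≤ ε₀ → 0 < p.δ → p.δ ≤ 1 / 2 → 0 < p.σ → p.σ < 1 →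
          Real.log (1 / p.δ) / (p.ε * p.σ) ≤ (p.N : ℝ) ^ φ p.N →
          TaggedSample.sampleScale a₀ k₀ p.N p.ε p.δ p.σ ≤ p.s →
          (p.s : ℝ) ≤ K * TaggedSample.sampleScale a k p.N p.ε p.δ p.σ →
          ∀ D : PMF (Fin p.N), (∀ x, TaggedSample.mass D x ≤ p.pMax) →
            3 / 4 ≤ TaggedSample.runLaw p D (TaggedSample.honestProver p D)
              {ω | TaggedSample.Accepts p ω ∧
                TaggedSample.heavyError p D ω.1.1 ω.1.2 ≤ C * p.σ ^ 3 ∧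
                TaggedSample.lightMass p D ω.1.1 ω.1.2 ≤ C * (p.σ / p.N)} ∧
            ∀ P : TaggedSample.Prover p, IsMarkovKernel P →
              3 / 4 ≤ TaggedSample.runLaw p D P
                {ω | TaggedSample.Accepts p ω →
                  TaggedSample.heavyError p D ω.1.1 ω.1.2 ≤ C * p.σ ∧
                  TaggedSample.lightMass p D ω.1.1 ω.1.2 ≤ C * (p.σ / p.N)} := by
  -- `20` covers `18 + 3/2` from tested and untested bins. Cubing the lower bound on `s` turns `2`
  -- and `5` into `ℓ⁶` and `σ⁻¹⁵`, the latter matching `σ⁻⁹` from `main` times `σ⁻⁶` from `B²`.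
  refine ⟨20, 2, 5, by norm_num, fun ε₀ K a k φ hφ => ?_⟩
  obtain ⟨N₀, hN₀⟩ := eventually_atTop.1 (TaggedSample.eventually_regular ε₀ K a k φ hφ)
  refine ⟨N₀, fun p hN hε hε₀ hδ hδ' hσ hσ' hQ hs hs' D hD => ?_⟩
  have h := hN₀ p.N hN p rfl hε hε₀ hδ hδ' hσ hσ' hQ hs hs'
  exact ⟨h.completeness D hD, fun P _ => h.soundness D hD P⟩
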